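/- Let $\mathbb K$ be $\mathbb R$ or $\mathbb C$. For a finite set $S\subset\mathbb N$ let $J(S,n)$ be the set of strictly increasing maps $S\to[n]=\{1,\dots,n\}$, and $J(d,n)=J([d],n)$. For a family $a=(a_{\mathbf i})_{\mathbf i\in J(d,n)}$ in $\mathbb K$ let $P_a(x)=\sum_{\mathbf i\in J(d,n)}a_{\mathbf i}\,x_{\mathbf i(1)}\cdots x_{\mathbf i(d)}$ be the corresponding $d$-homogeneous multilinear polynomial on $\{-1,1\}^n$, and $\|P_a\|_\infty=\max_{x\in\{-1,1\}^n}|P_a(x)|$. For $S\subseteq[d]$, $\hat S=[d]\setminus S$, $\mathbf i\in J(S,n)$, $\mathbf j\in J(\hat S,n)$, let $\mathbf i\oplus\mathbf j:[d]\to[n]$ be the map equal to $\mathbf i$ on $S$ and to $\mathbf j$ on $\hat S$; put $a^\flat_{\mathbf i\oplus\mathbf j}=a_{r(\mathbf i\oplus\mathbf j)}$, with $r$ the strictly increasing rearrangement, if $\mathbf i\oplus\mathbf j$ is injective, and $a^\flat_{\mathbf i\oplus\mathbf j}=0$ otherwise. Let $BH^{=d}\in[0,\infty]$ be the least $C$ such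 that $\big(\sum_{\mathbf i}|a_{\mathbf i}|^{\frac{2d}{d+1}}\big)^{\frac{d+1}{2d}}\le C\|P_a\|_\infty$ for all $n$ and all $a$, and let $BH^{=d}_{\mathrm{const}}$ be the least such $C$ when only families $a$ with all $|a_{\mathbf i}|$ equal are considered. Write $$F(d,k)=e^{\frac{d-k}{2k}}\,\frac{d^d}{k^k(d-k)^{d-k}}\Big(\frac dk\Big)^k .$$ 1. For all $1\le k\le d$, all $n$, and all $a$ with all $|a_{\mathbf i}|$ equal, $$\Big(\sum_{\mathbf i\in J(d,n)}|a_{\mathbf i}|^{\frac{2d}{d+1}}\Big)^{\frac{d+1}{2d}}\le\binom dk^{-\frac12}\Bigg[\prod_{S\subseteq[d],\,|S|=d-k}\Big(\sum_{\mathbf j\in J(\hat S,n)}\Big\{\sum_{\mathbf i\in J(S,n)}|a^\flat_{\mathbf i\oplus\mathbf j}|^2\Big\}^{\frac12\cdot\frac{2k}{k+1}}\Big)^{\frac{k+1}{2k}}\Bigg]^{\binom dk^{-1}}.$$ 2. For every $k\ge1$, $0<BH^{=k}<\infty$; and there is an absolute constant $C>0$ such that for all $d,k$ with $1\le k\le d/2$,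 $$\frac{BH^{=d}_{\mathrm{const}}}{BH^{=k}}\le C\,\binom dk^{-\frac12}F(d,k).$$ 3. As $d\to\infty$, $$\log\min_{1\le k\le d/2}\binom dk^{-\frac12}F(d,k)=\Big(\sqrt{3/2}+o(1)\Big)\sqrt{d\log d},$$ while without the gained factor, as in the argument of Defant, Mastyło and Pérez for general coefficients, $$\log\min_{1\le k\le d/2}F(d,k)=\big(\sqrt2+o(1)\big)\sqrt{d\log d}.$$ Moreover, for every $C_0>\sqrt{3/2}$ (in particular for some $C_0<\sqrt2$) there is a constant $C=C(C_0)$ such that $BH^{=d}_{\mathrm{const}}\le C\,e^{C_0\sqrt{d\log d}}$ for all $d\ge1$. -/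

import Mathlib

open scoped ENNReal Topology BigOperators

noncomputable section

/-- `J(S, n)`: the strictly increasing maps from a finite linearly ordered set into `[n]`. -/
abbrev IncMap (ι : Type) [LinearOrder ι] (n : ℕ) : Type := ι ↪o Fin n

instance IncMap.instFintype (ι : Type) [LinearOrder ι] [Finite ι] (n : ℕ) :
    Fintype (ι ↪o Fin n) :=
  haveI : Finite (ι ↪o Fin n) :=
    Finite.of_injective (fun f : ι ↪o Fin n => (f : ι → Fin n)) DFunLike.coe_injective
  Fintype.ofFinite _

/-- `i ⊕ j`: the map `[d] → [n]` equal to `i` on `S` and to `j` on the complement of `S`. -/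
def glue {d n : ℕ} (S : Finset (Fin d)) (i : IncMap S n)
    (j : IncMap (Sᶜ : Finset (Fin d)) n) : Fin d → Fin n :=
  fun s => if h : s ∈ S then i ⟨s, h⟩ else j ⟨s, Finset.mem_compl.mpr h⟩

/-- The strictly increasing rearrangement of an injective map `f : [d] → [n]`. -/
def rearrange {d n : ℕ} (f : Fin d → Fin n) (hf : Function.Injective f) : IncMap (Fin d) n :=
  (Finset.univ.image f).orderEmbOfFin
    (by rw [Finset.card_image_of_injective _ hf, Finset.card_univ, Fintype.card_fin])

open Classical in
/-- The coefficient `a♭` of an arbitrary map `f : [d] → [n]`: that of the strictly increasing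
rearrangement of `f` if `f` is injective, and `0` otherwise. -/
def flatCoeff {𝕜 : Type*} [RCLike 𝕜] {d n : ℕ} (a : IncMap (Fin d) n → 𝕜)
    (f : Fin d → Fin n) : 𝕜 :=
  if hf : Function.Injective f then a (rearrange f hf) else 0

/-- `(∑_{i ∈ J(d, n)} |a_i|^{2d/(d+1)})^{(d+1)/(2d)}`. -/
def coeffNorm {𝕜 : Type*} [RCLike 𝕜] {d n : ℕ} (a : IncMap (Fin d) n → 𝕜) : ℝ :=
  (∑ i, ‖a i‖ ^ ((2 * d : ℝ) / (d + 1))) ^ (((d : ℝ) + 1) / (2 * d))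

/-- The mixed-norm side of Blei's inequality: the geometric mean, over all `S ⊆ [d]` with
`|S| = d - k`, of
`(∑_{j ∈ J(Sᶜ, n)} (∑_{i ∈ J(S, n)} |a♭_{i ⊕ j}|²)^{(1/2) (2k/(k+1))})^{(k+1)/(2k)}`. -/
def bleiMean {𝕜 : Type*} [RCLike 𝕜] {d n : ℕ} (k : ℕ) (a : IncMap (Fin d) n → 𝕜) : ℝ :=
  (∏ S ∈ Finset.powersetCard (d - k) (Finset.univ : Finset (Fin d)),
      (∑ j : IncMap (Sᶜ : Finset (Fin d)) n,
        (∑ i : IncMap S n, ‖flatCoeff a (glue S i j)‖ ^ 2) ^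
          ((1 / 2 : ℝ) * ((2 * k : ℝ) / (k + 1)))) ^ (((k : ℝ) + 1) / (2 * k)))
    ^ ((d.choose k : ℝ)⁻¹)

/-- The homogeneous multilinear polynomial `P(x) = ∑_{i ∈ J(d, n)} a_i x_{i(1)} ⋯ x_{i(d)}` at a
point `x` of the Boolean cube `{-1, 1}^n` (recall that `ℤˣ = {-1, 1}`). -/
def cubePoly {𝕜 : Type*} [RCLike 𝕜] {d n : ℕ} (a : IncMap (Fin d) n → 𝕜)
    (x : Fin n → ℤˣ) : 𝕜 :=
  ∑ i, a i * ∏ s, (((x (i s) : ℤˣ) : ℤ) : 𝕜)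

/-- The maximum of `|P|` over the Boolean cube. -/
def cubeNorm {𝕜 : Type*} [RCLike 𝕜] {d n : ℕ} (a : IncMap (Fin d) n → 𝕜) : ℝ :=
  ⨆ x : Fin n → ℤˣ, ‖cubePoly a x‖

/-- All coefficients have the same modulus. -/
def ConstModulus {𝕜 : Type*} [RCLike 𝕜] {d n : ℕ} (a : IncMap (Fin d) n → 𝕜) : Prop :=
  ∀ i j, ‖a i‖ = ‖a j‖

/-- The Boolean Bohnenblust–Hille constant `BH^{=d}`: the best constant `C` such that
`coeffNorm a ≤ C * cubeNorm a` for all `d`-homogeneous multilinear polynomials, in any number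
of variables (`⊤` if there is no such finite constant). -/
def BH (𝕜 : Type*) [RCLike 𝕜] (d : ℕ) : ℝ≥0∞ :=
  sInf {C : ℝ≥0∞ | ∀ (n : ℕ) (a : IncMap (Fin d) n → 𝕜),
    ENNReal.ofReal (coeffNorm a) ≤ C * ENNReal.ofReal (cubeNorm a)}

/-- The same best constant, over the polynomials whose coefficients all have the same modulus. -/
def BHConst (𝕜 : Type*) [RCLike 𝕜] (d : ℕ) : ℝ≥0∞ :=
  sInf {C : ℝ≥0∞ | ∀ (n : ℕ) (a : IncMap (Fin d) n → 𝕜), ConstModulus a →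
    ENNReal.ofReal (coeffNorm a) ≤ C * ENNReal.ofReal (cubeNorm a)}

/-- `e^{(d-k)/(2k)} · d^d / (k^k (d-k)^{d-k}) · (d/k)^k`. -/
def plainFactor (d k : ℕ) : ℝ :=
  Real.exp (((d : ℝ) - k) / (2 * k)) *
    ((d : ℝ) ^ d / ((k : ℝ) ^ k * ((d : ℝ) - k) ^ (d - k))) * ((d : ℝ) / k) ^ k

/-- `plainFactor` with the gain `binom(d,k)^{-1/2}`. -/
def gainFactor (d k : ℕ) : ℝ :=
  (d.choose k : ℝ) ^ (-(1 / 2) : ℝ) * plainFactor d k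

end

/-! The ratio estimate and the final bound both come from one stronger inequality,
`exists_BHConst_le_exp`: the constant-modulus constant is `O(exp ((6/5) √(d log d)))`, and `6/5 <
√(3/2)`. Since `BH 𝕜 k ≥ 1` and `gainFactor d k ≥ c₀ exp ((6/5) √(d log d))` uniformly in `k`, the
ratio estimate follows with no comparison at fixed `k`.

For coefficients of constant modulus every inner sum in Blei's inequality is the same binomial
number, so both sides are explicit. The gain is the identity `C(n,d) C(d,k) = C(n,k) C(n-k,d-k)`,
together with the monotonicity of `C(n,m)^(1/m)` (`choose_mul_rpow_le`).

For the stronger inequality, let `P` be the polynomial and take the part of `P(u + v)` of degree `k`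
in `u`. The Bohnenblust-Hille inequality in `u`, with a constant `C^k`, and hypercontractivity in
`v`, at a cost `3^((d-k)/k)`, control the mixed norm. What remains is the sup norm of that part
(`exists_norm_mixedPart_le`): `P(su + tv)` is a binary form bounded for real `|s| + |t| ≤ 1`, and a
maximum principle argument bounds it at complex points near the real line. Cauchy's estimate then
gives a cost of about `(d/k)^((21/20) k)`, where `plainFactor` has about `(d/k)^(2k)`. After the
gain `(d/k)^(-k/2)`, the choice `k ≈ 2 √(d / log d)` gives an exponent below `6/5`.

The two limits follow from elementary bounds on the factors and the arithmetic-geometric mean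
inequality in `k` (`eventually_le_cost`). -/

set_option linter.unusedSectionVars false

/-! ### Walsh polynomials: Parseval and hypercontractivity. -/

section Cube

variable {ι : Type} [Fintype ι] [DecidableEq ι]

/-- The Walsh function of a set `S` of coordinates of the Boolean cube. -/
def walsh (S : Finset ι) (x : ι → ℤˣ) : ℂ := ∏ i ∈ S, (((x i : ℤˣ) : ℤ) : ℂ)

/-- The part of a Walsh polynomial that uses only the variables in `T`. -/
def walshPart (F : Finset ι → ℂ) (T : Finset ι) (x : ι → ℤˣ) : ℂ :=
  ∑ S ∈ T.powerset, F S * walsh S x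

/-- The Walsh polynomial with coefficients `F`. -/
def walshPoly (F : Finset ι → ℂ) (x : ι → ℤˣ) : ℂ := ∑ S, F S * walsh S x

lemma walshPart_univ (F : Finset ι → ℂ) : walshPart F Finset.univ = walshPoly F := by
  funext x
  simp [walshPart, walshPoly]

lemma walshPart_insert (F : Finset ι → ℂ) {T : Finset ι} {i : ι} (hi : i ∉ T) (x : ι → ℤˣ) :
    walshPart F (insert i T) x =
      walshPart F T x + (((x i : ℤˣ) : ℤ) : ℂ) * walshPart (fun S => F (insert i S)) T x := by
  unfold walshPart
  rw [Finset.sum_powerset_insert hi, Finset.mul_sum]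
  congr 1
  refine Finset.sum_congr rfl fun S hS => ?_
  have hiS : i ∉ S := fun h => hi (Finset.mem_powerset.mp hS h)
  unfold walsh
  rw [Finset.prod_insert hiS]
  ring

lemma walshPart_mulSingle_mul (F : Finset ι → ℂ) {T : Finset ι} {i : ι} (hi : i ∉ T)
    (x : ι → ℤˣ) : walshPart F T (Pi.mulSingle i (-1) * x) = walshPart F T x := by
  refine Finset.sum_congr rfl fun S hS => ?_
  congr 1
  refine Finset.prod_congr rfl fun j hj => ?_
  have hji : j ≠ i := by
    rintro rfl
    exact hi (Finset.mem_powerset.mp hS hj)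
  simp [Pi.mulSingle_eq_of_ne hji]

/-- Each point is paired with its reflection in coordinate `i`; the two values are `g + h` and `g -
h` in some order. A general `φ` serves both the second and the fourth moment. -/
lemma two_mul_sum_comp_walshPart_insert (F : Finset ι → ℂ) {T : Finset ι} {i : ι} (hi : i ∉ T)
    (φ : ℂ → ℝ) :
    2 * ∑ x, φ (walshPart F (insert i T) x) =
      ∑ x : ι → ℤˣ, (φ (walshPart F T x + walshPart (fun S => F (insert i S)) T x) +
        φ (walshPart F T x - walshPart (fun S => F (insert i S)) T x)) := by
  have h : ∑ x, φ (walshPart F (insert i T) x) =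
      ∑ x, φ (walshPart F (insert i T) (Pi.mulSingle i (-1) * x)) :=
    (Fintype.sum_equiv (Equiv.mulLeft (Pi.mulSingle i (-1))) _ _ fun x => rfl).symm
  rw [two_mul]
  nth_rewrite 2 [h]
  rw [← Finset.sum_add_distrib]
  refine Finset.sum_congr rfl fun x _ => ?_
  rw [walshPart_insert F hi, walshPart_insert F hi, walshPart_mulSingle_mul _ hi,
    walshPart_mulSingle_mul _ hi]
  rcases Int.units_eq_one_or (x i) with h1 | h1
  · simp [h1, sub_eq_add_neg]
  · simp [h1, sub_eq_add_neg, add_comm]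

/-- Parseval's identity. -/
lemma sum_norm_walshPart_sq (T : Finset ι) (F : Finset ι → ℂ) :
    ∑ x : ι → ℤˣ, ‖walshPart F T x‖ ^ 2 =
      Fintype.card (ι → ℤˣ) * ∑ S ∈ T.powerset, ‖F S‖ ^ 2 := by
  induction T using Finset.induction_on generalizing F with
  | empty => simp [walshPart, walsh]
  | insert i T hi ih =>
    have h := two_mul_sum_comp_walshPart_insert F hi (fun z => ‖z‖ ^ 2)
    have h2 : ∀ g h : ℂ, ‖g + h‖ ^ 2 + ‖g - h‖ ^ 2 = 2 * (‖g‖ ^ 2 + ‖h‖ ^ 2) := fun g h => by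
      have := parallelogram_law_with_norm ℝ g h
      nlinarith
    simp only [h2] at h
    rw [← Finset.mul_sum, Finset.sum_add_distrib, ih, ih] at h
    rw [Finset.sum_powerset_insert hi, mul_add]
    linarith

/-- The two sides differ by `8 (Im (g * conj h))²`, so real multiples of one vector are the extremal
case. -/
lemma norm_add_pow_four_add_norm_sub_pow_four_le (g h : ℂ) :
    ‖g + h‖ ^ 4 + ‖g - h‖ ^ 4 ≤ 2 * (‖g‖ ^ 4 + 6 * (‖g‖ ^ 2 * ‖h‖ ^ 2) + ‖h‖ ^ 4) := by
  have e : ∀ z : ℂ, ‖z‖ ^ 4 = (z.re * z.re + z.im * z.im) ^ 2 := fun z => by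
    rw [← Complex.normSq_apply, ← Complex.sq_norm]; ring
  simp only [e, Complex.sq_norm, Complex.normSq_apply, Complex.add_re, Complex.add_im,
    Complex.sub_re, Complex.sub_im]
  nlinarith [sq_nonneg (g.re * h.im - g.im * h.re)]

/-- Bonami's hypercontractive inequality for the fourth moment. -/
lemma sum_norm_walshPart_pow_four_le (T : Finset ι) (F : Finset ι → ℂ) :
    ∑ x : ι → ℤˣ, ‖walshPart F T x‖ ^ 4 ≤
      Fintype.card (ι → ℤˣ) * (∑ S ∈ T.powerset, 3 ^ S.card * ‖F S‖ ^ 2) ^ 2 := by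
  induction T using Finset.induction_on generalizing F with
  | empty => simp [walshPart, walsh, ← pow_mul]
  | insert i T hi ih =>
    have h := two_mul_sum_comp_walshPart_insert F hi (fun z => ‖z‖ ^ 4)
    set G : Finset ι → ℂ := fun S => F (insert i S) with hG
    set N : ℝ := ((Fintype.card (ι → ℤˣ) : ℕ) : ℝ)
    have hN : 0 ≤ N := Nat.cast_nonneg _
    set A := ∑ S ∈ T.powerset, (3 : ℝ) ^ S.card * ‖F S‖ ^ 2
    set B := ∑ S ∈ T.powerset, (3 : ℝ) ^ S.card * ‖G S‖ ^ 2
    have hA : 0 ≤ A := Finset.sum_nonneg fun S _ => by positivity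
    have hB : 0 ≤ B := Finset.sum_nonneg fun S _ => by positivity
    have hF := ih F
    have hG' := ih G
    have hsplit : ∑ S ∈ (insert i T).powerset, (3 : ℝ) ^ S.card * ‖F S‖ ^ 2 = A + 3 * B := by
      rw [Finset.sum_powerset_insert hi, Finset.mul_sum]
      congr 1
      refine Finset.sum_congr rfl fun S hS => ?_
      rw [Finset.card_insert_of_notMem fun h => hi (Finset.mem_powerset.mp hS h), pow_succ]
      ring
    have hcross : ∑ x : ι → ℤˣ, ‖walshPart F T x‖ ^ 2 * ‖walshPart G T x‖ ^ 2 ≤ N * (A * B) := by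
      have hcs := Finset.sum_mul_sq_le_sq_mul_sq Finset.univ
        (fun x : ι → ℤˣ => ‖walshPart F T x‖ ^ 2) (fun x => ‖walshPart G T x‖ ^ 2)
      simp only [← pow_mul] at hcs
      norm_num at hcs
      refine abs_le_of_sq_le_sq' ?_ (by positivity) |>.2
      calc _ ≤ _ := hcs
        _ ≤ (N * A ^ 2) * (N * B ^ 2) := by gcongr
        _ = _ := by ring
    have hle : 2 * ∑ x, ‖walshPart F (insert i T) x‖ ^ 4 ≤
        2 * (N * A ^ 2 + 6 * (N * (A * B)) + N * B ^ 2) := by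
      rw [h]
      refine (Finset.sum_le_sum fun x _ =>
        norm_add_pow_four_add_norm_sub_pow_four_le _ _).trans ?_
      rw [← Finset.mul_sum, Finset.sum_add_distrib, Finset.sum_add_distrib, ← Finset.mul_sum]
      gcongr
    rw [hsplit]
    -- The weight `3` makes the cross term of `(A + 3B)²` equal to the `6AB` above; `8B²` is left
    -- over.
    nlinarith [mul_nonneg hN (sq_nonneg B)]

/-- Comparison of the second and the `p`-th moment of an `m`-homogeneous Walsh polynomial. -/
lemma card_mul_sum_norm_sq_rpow_le (m : ℕ) (F : Finset ι → ℂ) (hF : ∀ S, F S ≠ 0 → S.card = m)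
    {p : ℝ} (hp0 : 0 < p) (hp2 : p < 2) :
    Fintype.card (ι → ℤˣ) * (∑ S, ‖F S‖ ^ 2) ^ (p / 2) ≤
      3 ^ (m * (2 - p)) * ∑ x, ‖walshPoly F x‖ ^ p := by
  set N : ℝ := ((Fintype.card (ι → ℤˣ) : ℕ) : ℝ)
  have hN : 0 < N := Nat.cast_pos.mpr Fintype.card_pos
  set σ : ℝ := ∑ S, ‖F S‖ ^ 2
  have hσ : 0 ≤ σ := by positivity
  set Y : ℝ := ∑ x, ‖walshPoly F x‖ ^ p
  have hY : 0 ≤ Y := by positivity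
  rcases hσ.eq_or_lt with h0 | hσ
  · rw [← h0, Real.zero_rpow (by positivity), mul_zero]
    positivity
  have h2 : ∑ x, ‖walshPoly F x‖ ^ 2 = N * σ := by
    have := sum_norm_walshPart_sq Finset.univ F
    simpa only [walshPart_univ, Finset.powerset_univ] using this
  have h4 : ∑ x, ‖walshPoly F x‖ ^ 4 ≤ N * (3 ^ m * σ) ^ 2 := by
    have := sum_norm_walshPart_pow_four_le Finset.univ F
    simp only [walshPart_univ, Finset.powerset_univ] at this
    refine this.trans_eq ?_
    congr 2
    rw [Finset.mul_sum]
    refine Finset.sum_congr rfl fun S _ => ?_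
    by_cases hS : F S = 0
    · simp [hS]
    · rw [hF S hS]
  have hp4 : 0 < 4 - p := by linarith
  have hp2' : 0 < 2 - p := by linarith
  -- Interpolation of the second moment between the `p`-th and the fourth: `2 = p * (2/(4-p)) + 4 *
  -- ((2-p)/(4-p))`.
  have hconj : ((4 - p) / 2).HolderConjugate ((4 - p) / (2 - p)) := by
    rw [Real.holderConjugate_iff]
    constructor
    · linarith
    · field_simp
      ring
  have hH := Real.inner_le_Lp_mul_Lq_of_nonneg (s := Finset.univ)
    (f := fun x => ‖walshPoly F x‖ ^ (p * (2 / (4 - p))))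
    (g := fun x => ‖walshPoly F x‖ ^ (4 * ((2 - p) / (4 - p)))) hconj
    (fun x _ => by positivity) (fun x _ => by positivity)
  have e1 : ∀ x, ‖walshPoly F x‖ ^ (p * (2 / (4 - p))) *
      ‖walshPoly F x‖ ^ (4 * ((2 - p) / (4 - p))) = ‖walshPoly F x‖ ^ 2 := fun x => by
    rw [← Real.rpow_add_of_nonneg (norm_nonneg _) (by positivity) (by positivity),
      ← Real.rpow_natCast]
    congr 1
    field_simp
    push_cast
    ring
  have e2 : ∀ x, (‖walshPoly F x‖ ^ (p * (2 / (4 - p)))) ^ ((4 - p) / 2) =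
      ‖walshPoly F x‖ ^ p := fun x => by
    rw [← Real.rpow_mul (norm_nonneg _)]
    congr 1
    field_simp
  have e3 : ∀ x, (‖walshPoly F x‖ ^ (4 * ((2 - p) / (4 - p)))) ^ ((4 - p) / (2 - p)) =
      ‖walshPoly F x‖ ^ 4 := fun x => by
    rw [← Real.rpow_mul (norm_nonneg _), ← Real.rpow_natCast]
    congr 1
    field_simp
    norm_num
  simp only [e1, e2, e3, h2] at hH
  have hH2 : N * σ ≤ Y ^ (1 / ((4 - p) / 2)) * (N * (3 ^ m * σ) ^ 2) ^ (1 / ((4 - p) / (2 - p))) :=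
    hH.trans (by gcongr)
  have hH3 := Real.rpow_le_rpow (by positivity) hH2 (z := (4 - p) / 2) (by positivity)
  have hl : (N * σ) ^ ((4 - p) / 2) =
      (N ^ ((2 - p) / 2) * σ ^ (2 - p)) * (N * σ ^ (p / 2)) := by
    rw [Real.mul_rpow hN.le hσ.le, show (4 - p) / 2 = (2 - p) / 2 + 1 by ring,
      Real.rpow_add hN, Real.rpow_one, show (2 - p) / 2 + 1 = (2 - p) + p / 2 by ring,
      Real.rpow_add hσ]
    ring
  rw [hl] at hH3
  rw [Real.mul_rpow (x := Y ^ (1 / ((4 - p) / 2))) (by positivity) (by positivity),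
    ← Real.rpow_mul hY, ← Real.rpow_mul (by positivity), show 1 / ((4 - p) / 2) * ((4 - p) / 2) = 1 by field_simp,
    show 1 / ((4 - p) / (2 - p)) * ((4 - p) / 2) = (2 - p) / 2 by field_simp,
    Real.rpow_one, Real.mul_rpow hN.le (by positivity), ← Real.rpow_natCast (3 ^ m * σ) 2,
    ← Real.rpow_mul (by positivity), show ((2 : ℕ) : ℝ) * ((2 - p) / 2) = 2 - p by push_cast; ring,
    Real.mul_rpow (by positivity) hσ.le, ← Real.rpow_natCast 3 m,
    ← Real.rpow_mul (by positivity)] at hH3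
  refine le_of_mul_le_mul_left (hH3.trans_eq ?_) (show 0 < N ^ ((2 - p) / 2) * σ ^ (2 - p) by
    positivity)
  ring

end Cube

/-! ### Binary forms bounded on the real `ℓ₁`-ball: growth at complex points and coefficients. -/

section BinaryForms

/-- The binary form of degree `d` with coefficients `c`. -/
def binForm (c : ℕ → ℂ) (d : ℕ) (s t : ℂ) : ℂ :=
  ∑ j ∈ Finset.range (d + 1), c j * s ^ j * t ^ (d - j)

lemma binForm_mul_mul (c : ℕ → ℂ) (d : ℕ) (l s t : ℂ) :
    binForm c d (l * s) (l * t) = l ^ d * binForm c d s t := by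
  unfold binForm
  rw [Finset.mul_sum]
  refine Finset.sum_congr rfl fun j hj => ?_
  have hj' : j ≤ d := Nat.lt_succ_iff.mp (Finset.mem_range.mp hj)
  conv_rhs => rw [← Nat.add_sub_of_le hj', pow_add, Nat.add_sub_of_le hj']
  ring

lemma binForm_neg_one_pow_mul (c : ℕ → ℂ) (d : ℕ) (s t : ℂ) :
    binForm (fun j => (-1) ^ j * c j) d s t = binForm c d (-s) t := by
  unfold binForm
  refine Finset.sum_congr rfl fun j _ => ?_
  rw [neg_pow s]
  ring

lemma differentiable_binForm (c : ℕ → ℂ) (d : ℕ) {f g : ℂ → ℂ} (hf : Differentiable ℂ f)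
    (hg : Differentiable ℂ g) : Differentiable ℂ fun w => binForm c d (f w) (g w) := by
  unfold binForm
  fun_prop

lemma norm_binForm_le_mul_pow {c : ℕ → ℂ} {d : ℕ} {M : ℝ}
    (h : ∀ s t : ℝ, |s| + |t| ≤ 1 → ‖binForm c d s t‖ ≤ M) (s t : ℝ) (hst : 0 < |s| + |t|) :
    ‖binForm c d s t‖ ≤ M * (|s| + |t|) ^ d := by
  set l := |s| + |t|
  have h1 := h (s / l) (t / l) (by
    rw [abs_div, abs_div, abs_of_pos hst, ← add_div, div_self hst.ne'])
  have h2 := binForm_mul_mul c d l ((s / l : ℝ) : ℂ) ((t / l : ℝ) : ℂ)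
  rw [← Complex.ofReal_mul, ← Complex.ofReal_mul, mul_div_cancel₀ _ hst.ne',
    mul_div_cancel₀ _ hst.ne'] at h2
  rw [h2, norm_mul, norm_pow, Complex.norm_real, Real.norm_of_nonneg hst.le, mul_comm]
  gcongr

/-- In the right half-plane the argument of `z ^ a` stays within `a π/2`, short of a right angle.
Hence `Re z ^ a` is a harmonic function comparable with `‖z‖ ^ a`. -/
lemma cos_mul_norm_rpow_le_re_cpow {a : ℝ} (ha0 : 0 < a) (ha1 : a < 1) {z : ℂ} (hz : 0 < z.re) :
    Real.cos (a * (Real.pi / 2)) * ‖z‖ ^ a ≤ (z ^ (a : ℂ)).re := by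
  have hz0 : z ≠ 0 := by
    rintro rfl
    simp at hz
  have harg := Complex.abs_arg_le_pi_div_two_iff.mpr hz.le
  rw [Complex.cpow_def_of_ne_zero hz0, Complex.exp_re, Complex.re_mul_ofReal,
    Complex.im_mul_ofReal, Complex.log_re, Complex.log_im, Real.rpow_def_of_pos (norm_pos_iff.mpr hz0),
    mul_comm]
  gcongr
  rw [← Real.cos_abs (z.arg * a), abs_mul, abs_of_pos ha0, mul_comm]
  apply Real.cos_le_cos_of_nonneg_of_le_pi
  · positivity
  · nlinarith [Real.pi_pos]
  · gcongr

/-- The values of a binary form on the unit circle, in the coordinates in which it is a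
trigonometric polynomial. -/
lemma norm_binForm_circle_le {c : ℕ → ℂ} {d : ℕ} {M : ℝ} (hM : 0 ≤ M)
    (h : ∀ s t : ℝ, |s| + |t| ≤ 1 → ‖binForm c d s t‖ ≤ M) {w : ℂ} (hw : ‖w‖ = 1) :
    ‖binForm c d ((w - 1) / (2 * Complex.I)) ((w + 1) / 2)‖ ≤ M * Real.exp (d * (‖1 - w‖ / 2)) := by
  set θ : ℝ := w.arg / 2
  set l : ℂ := Complex.exp (θ * Complex.I)
  have hl : ‖l‖ = 1 := Complex.norm_exp_ofReal_mul_I θ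
  have hl0 : l ≠ 0 := Complex.exp_ne_zero _
  have hw2 : w = l * l := by
    rw [← Complex.exp_add, ← two_mul, ← mul_assoc]
    conv_lhs => rw [← Complex.norm_mul_exp_arg_mul_I w, hw]
    simp only [θ]
    push_cast
    rw [one_mul]
    congr 1
    ring
  have hl' : Complex.exp (θ * Complex.I) = l := rfl
  have hinv : Complex.exp (-(θ * Complex.I)) = l⁻¹ := Complex.exp_neg _
  have hs : (w - 1) / (2 * Complex.I) = l * ((Real.sin θ : ℝ) : ℂ) := by
    rw [Complex.ofReal_sin, Complex.sin, neg_mul, hinv, hl', hw2]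
    field_simp
    rw [Complex.I_sq]
    ring
  have ht : (w + 1) / 2 = l * ((Real.cos θ : ℝ) : ℂ) := by
    rw [Complex.ofReal_cos, Complex.cos, neg_mul, hinv, hl', hw2]
    field_simp
  have hsin : |Real.sin θ| = ‖1 - w‖ / 2 := by
    have := congrArg norm hs
    rw [norm_mul, hl, one_mul, Complex.norm_real, norm_div, norm_mul, Complex.norm_I, mul_one,
      Complex.norm_two, norm_sub_rev, Real.norm_eq_abs] at this
    exact this.symm
  have hpos : 0 < |Real.sin θ| + |Real.cos θ| := by
    rcases eq_or_ne (Real.sin θ) 0 with h0 | h0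
    · have : Real.cos θ ≠ 0 := fun h1 => by
        have := Real.sin_sq_add_cos_sq θ
        rw [h0, h1] at this
        norm_num at this
      positivity
    · positivity
  rw [hs, ht, binForm_mul_mul, norm_mul, norm_pow, hl, one_pow, one_mul]
  refine (norm_binForm_le_mul_pow h _ _ hpos).trans ?_
  gcongr
  rw [← hsin, Real.exp_nat_mul]
  gcongr
  have h1 := Real.abs_cos_le_one θ
  have h2 := Real.add_one_le_exp |Real.sin θ|
  linarith

/-- The values of a binary form inside the unit disc, by the maximum principle. -/
lemma norm_binForm_disc_le {a : ℝ} (ha0 : 0 < a) (ha1 : a < 1) {c : ℕ → ℂ} {d : ℕ} {M : ℝ}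
    (hM : 0 ≤ M) (h : ∀ s t : ℝ, |s| + |t| ≤ 1 → ‖binForm c d s t‖ ≤ M) {w : ℂ} (hw : ‖w‖ ≤ 1)
    {δ : ℝ} (hδ : 0 < δ) :
    ‖binForm c d ((w - 1) / (2 * Complex.I)) ((w + 1) / 2)‖ ≤
      M * Real.exp ((Real.cos (a * (Real.pi / 2)))⁻¹ * d * (δ + ‖1 - w‖) ^ a) := by
  have hcos : 0 < Real.cos (a * (Real.pi / 2)) := by
    apply Real.cos_pos_of_mem_Ioo
    constructor <;> nlinarith [Real.pi_pos]
  set β := (Real.cos (a * (Real.pi / 2)))⁻¹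
  have hβ : 0 < β := inv_pos.mpr hcos
  set f : ℂ → ℂ := fun w => binForm c d ((w - 1) / (2 * Complex.I)) ((w + 1) / 2)
  -- `Re g` majorizes the exponent `d ‖1 - w‖ / 2` on the circle, and the maximum principle is
  -- applied to `f * exp (-g)`. The exponent `a < 1` is needed because the harmonic extension of `‖1
  -- - w‖` itself carries a logarithm at `1`; `δ` moves the branch point out of the closed disc.
  set g : ℂ → ℂ := fun w => ((β * d : ℝ) : ℂ) * (1 + δ - w) ^ (a : ℂ)
  have hre : ∀ w : ℂ, ‖w‖ ≤ 1 → δ ≤ (1 + δ - w).re := fun w hw => by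
    have := (Complex.re_le_norm w).trans hw
    simp only [Complex.sub_re, Complex.add_re, Complex.one_re, Complex.ofReal_re]
    linarith
  have hf : Differentiable ℂ f := differentiable_binForm c d (by fun_prop) (by fun_prop)
  have hg : DifferentiableOn ℂ g (Metric.closedBall 0 1) := fun w hw => by
    refine DifferentiableAt.differentiableWithinAt ?_
    refine DifferentiableAt.const_mul (DifferentiableAt.cpow_const (by fun_prop) ?_) _
    exact Or.inl (hδ.trans_le (hre w (by simpa using hw)))
  have hfg : DiffContOnCl ℂ (fun w => f w * Complex.exp (-g w)) (Metric.ball 0 1) := by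
    apply DifferentiableOn.diffContOnCl
    rw [closure_ball _ one_ne_zero]
    exact hf.differentiableOn.mul hg.neg.cexp
  have hbd : ∀ z ∈ frontier (Metric.ball (0 : ℂ) 1), ‖f z * Complex.exp (-g z)‖ ≤ M := by
    intro z hz
    rw [frontier_ball _ one_ne_zero, mem_sphere_zero_iff_norm] at hz
    rw [norm_mul, Complex.norm_exp, Complex.neg_re, Real.exp_neg, ← div_eq_mul_inv,
      div_le_iff₀ (Real.exp_pos _)]
    refine (norm_binForm_circle_le hM h hz).trans ?_
    gcongr
    have h1 := cos_mul_norm_rpow_le_re_cpow ha0 ha1 (hδ.trans_le (hre z hz.le))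
    have h2 : ‖1 - z‖ ≤ ‖1 + δ - z‖ := by
      have hz1 : 0 ≤ (1 - z).re := by
        have := (Complex.re_le_norm z).trans hz.le
        simp only [Complex.sub_re, Complex.one_re]
        linarith
      rw [show 1 + (δ : ℂ) - z = (1 - z) + δ by ring]
      refine le_of_sq_le_sq ?_ (norm_nonneg _)
      simp only [Complex.sq_norm, Complex.normSq_apply, Complex.add_re, Complex.add_im,
        Complex.ofReal_re, Complex.ofReal_im]
      nlinarith
    have h3 : ‖1 - z‖ / 2 ≤ ‖1 - z‖ ^ a := by
      have h4 : ‖1 - z‖ / 2 ≤ 1 := by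
        have := norm_sub_le 1 z
        rw [norm_one, hz] at this
        linarith
      calc ‖1 - z‖ / 2 = (‖1 - z‖ / 2) ^ (1 : ℝ) := (Real.rpow_one _).symm
        _ ≤ (‖1 - z‖ / 2) ^ a := by
          rcases (norm_nonneg (1 - z)).eq_or_lt with h0 | h0
          · rw [← h0, zero_div, Real.zero_rpow one_ne_zero, Real.zero_rpow ha0.ne']
          · exact Real.rpow_le_rpow_of_exponent_ge (by positivity) h4 ha1.le
        _ ≤ _ := by
          gcongr
          linarith [norm_nonneg (1 - z)]
    have h5 : ‖1 - z‖ ^ a ≤ ‖1 + δ - z‖ ^ a := by gcongr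
    have h6 : ‖1 + δ - z‖ ^ a ≤ β * ((1 + δ - z) ^ (a : ℂ)).re := by
      rw [← div_le_iff₀' hβ, div_inv_eq_mul, mul_comm]
      exact h1
    simp only [g, Complex.re_ofReal_mul]
    calc (d : ℝ) * (‖1 - z‖ / 2) ≤ d * (β * ((1 + δ - z) ^ (a : ℂ)).re) := by
          gcongr
          linarith
      _ = _ := by ring
  have key := Complex.norm_le_of_forall_mem_frontier_norm_le Metric.isBounded_ball hfg hbd
    (z := w) (by rw [closure_ball _ one_ne_zero]; simpa using hw)
  rw [norm_mul, Complex.norm_exp, Complex.neg_re, Real.exp_neg, ← div_eq_mul_inv,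
    div_le_iff₀ (Real.exp_pos _)] at key
  refine key.trans ?_
  gcongr
  simp only [g, Complex.re_ofReal_mul]
  gcongr
  refine (Complex.re_le_norm _).trans ?_
  rw [Complex.norm_cpow_real]
  gcongr
  rw [show 1 + (δ : ℂ) - w = δ + (1 - w) by ring]
  refine (norm_add_le _ _).trans ?_
  rw [Complex.norm_real, Real.norm_of_nonneg hδ.le]

/-- The growth of a binary form near the real line. -/
lemma norm_binForm_one_le {a : ℝ} (ha0 : 0 < a) (ha1 : a < 1) {c : ℕ → ℂ} {d : ℕ} {M : ℝ}
    (hM : 0 ≤ M) (h : ∀ s t : ℝ, |s| + |t| ≤ 1 → ‖binForm c d s t‖ ≤ M) {r : ℂ}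
    (hr : 0 < ‖r‖) (hr2 : ‖r‖ ≤ 1 / 2) (him : 0 ≤ r.im) :
    ‖binForm c d r 1‖ ≤
      M * Real.exp ((1 + 5 * (Real.cos (a * (Real.pi / 2)))⁻¹) * d * ‖r‖ ^ a) := by
  have hcos : 0 < Real.cos (a * (Real.pi / 2)) := by
    apply Real.cos_pos_of_mem_Ioo
    constructor <;> nlinarith [Real.pi_pos]
  set β := (Real.cos (a * (Real.pi / 2)))⁻¹
  have hβ : 0 < β := inv_pos.mpr hcos
  set ρ := ‖r‖
  set t : ℂ := 1 - Complex.I * r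
  have hIr : ‖Complex.I * r‖ = ρ := by rw [norm_mul, Complex.norm_I, one_mul]
  have ht1 : ‖t‖ ≤ 1 + ρ := by
    refine (norm_sub_le _ _).trans ?_
    rw [norm_one, hIr]
  have ht2 : 1 - ρ ≤ ‖t‖ := by
    have := norm_sub_norm_le 1 (Complex.I * r)
    rwa [norm_one, hIr] at this
  have ht0 : t ≠ 0 := norm_pos_iff.mp (by linarith)
  -- The Cayley transform sends the upper half-plane into the disc and `r = 0` to `w = 1`, where the
  -- bound is best. By homogeneity the form at `(r, 1)` is `t ^ d` times its value in the disc
  -- coordinates.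
  set w : ℂ := (1 + Complex.I * r) / t
  have hw : ‖w‖ ≤ 1 := by
    rw [norm_div, div_le_one (norm_pos_iff.mpr ht0)]
    refine le_of_sq_le_sq ?_ (norm_nonneg _)
    simp only [t, Complex.sq_norm, Complex.normSq_apply, Complex.add_re, Complex.add_im,
      Complex.sub_re, Complex.sub_im, Complex.mul_re, Complex.mul_im, Complex.I_re, Complex.I_im,
      Complex.one_re, Complex.one_im]
    nlinarith
  have e1 : (w - 1) / (2 * Complex.I) = t⁻¹ * r := by
    simp only [w]
    field_simp
    simp only [t]
    ring
  have e2 : (w + 1) / 2 = t⁻¹ * 1 := by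
    simp only [w]
    field_simp
    simp only [t]
    ring
  have h1w : ‖1 - w‖ ≤ 4 * ρ := by
    have : 1 - w = -(2 * (Complex.I * r)) / t := by
      simp only [w]
      field_simp
      simp only [t]
      ring
    rw [this, norm_div, norm_neg, norm_mul, hIr, Complex.norm_two,
      div_le_iff₀ (norm_pos_iff.mpr ht0)]
    nlinarith
  have key := norm_binForm_disc_le ha0 ha1 hM h hw hr
  rw [e1, e2, binForm_mul_mul, norm_mul, norm_pow, norm_inv, inv_pow,
    inv_mul_le_iff₀ (pow_pos (norm_pos_iff.mpr ht0) _)] at key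
  have hρa : ρ ≤ ρ ^ a := by
    conv_lhs => rw [← Real.rpow_one ρ]
    exact Real.rpow_le_rpow_of_exponent_ge hr (by linarith) ha1.le
  have h5 : (ρ + ‖1 - w‖) ^ a ≤ 5 * ρ ^ a := by
    calc (ρ + ‖1 - w‖) ^ a ≤ (5 * ρ) ^ a := by gcongr; linarith
      _ = 5 ^ a * ρ ^ a := Real.mul_rpow (by norm_num) hr.le
      _ ≤ 5 ^ (1 : ℝ) * ρ ^ a := by
        gcongr
        norm_num
      _ = _ := by rw [Real.rpow_one]
  calc ‖binForm c d r 1‖ ≤ ‖t‖ ^ d * (M * Real.exp (β * d * (ρ + ‖1 - w‖) ^ a)) := key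
    _ ≤ Real.exp (ρ ^ a) ^ d * (M * Real.exp (β * d * (5 * ρ ^ a))) := by
      gcongr
      linarith [Real.add_one_le_exp (ρ ^ a)]
    _ = _ := by
      rw [← Real.exp_nat_mul, mul_left_comm, ← Real.exp_add]
      congr 2
      ring

/-- Coefficients of a binary form that is bounded on the unit ball of the real `ℓ₁`-plane. -/
theorem norm_coeff_le_of_norm_binForm_le {a : ℝ} (ha0 : 0 < a) (ha1 : a < 1) :
    ∃ K : ℝ, 0 < K ∧ ∀ (d : ℕ) (c : ℕ → ℂ) (M : ℝ),
      (∀ s t : ℝ, |s| + |t| ≤ 1 → ‖binForm c d s t‖ ≤ M) →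
      ∀ ρ : ℝ, 0 < ρ → ρ ≤ 1 / 2 → ∀ k ≤ d,
        ‖c k‖ ≤ M * Real.exp (K * d * ρ ^ a) / ρ ^ k := by
  have hcos : 0 < Real.cos (a * (Real.pi / 2)) := by
    apply Real.cos_pos_of_mem_Ioo
    constructor <;> nlinarith [Real.pi_pos]
  refine ⟨1 + 5 * (Real.cos (a * (Real.pi / 2)))⁻¹, by positivity, fun d c M h ρ hρ hρ2 k hk => ?_⟩
  have hM : 0 ≤ M := (norm_nonneg _).trans (h 0 0 (by simp))
  set B := M * Real.exp ((1 + 5 * (Real.cos (a * (Real.pi / 2)))⁻¹) * d * ρ ^ a)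
  have hbd : ∀ r ∈ Metric.sphere (0 : ℂ) ρ, ‖binForm c d r 1‖ ≤ B := by
    intro r hr
    rw [mem_sphere_zero_iff_norm] at hr
    rcases le_total 0 r.im with him | him
    · simpa only [hr] using norm_binForm_one_le ha0 ha1 hM h (hr ▸ hρ) (hr.trans_le hρ2) him
    -- In the lower half-plane, `r` is replaced by `-r` at the price of alternating the signs of the
    -- coefficients.
    · have := norm_binForm_one_le (c := fun j => (-1) ^ j * c j) (r := -r) ha0 ha1 hM
        (fun s t hst => by
          rw [binForm_neg_one_pow_mul, ← Complex.ofReal_neg]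
          exact h _ _ (by rwa [abs_neg])) (by rwa [norm_neg, hr]) (by rwa [norm_neg, hr])
        (by simpa using him)
      rwa [binForm_neg_one_pow_mul, neg_neg, norm_neg, hr] at this
  set P : Polynomial ℂ := ∑ j ∈ Finset.range (d + 1), Polynomial.monomial j (c j)
  have hP : ∀ z, P.eval z = binForm c d z 1 := fun z => by
    simp [P, binForm, Polynomial.eval_finsetSum]
  have hcoeff : P.coeff k = c k := by
    simp only [P, Polynomial.finsetSum_coeff, Polynomial.coeff_monomial]
    rw [Finset.sum_ite_eq' ]
    simp [Nat.lt_succ_iff.mpr hk]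
  have hder : iteratedDeriv k (fun z => P.eval z) 0 = k.factorial * c k := by
    rw [← hcoeff]
    have : ∀ (m : ℕ) (Q : Polynomial ℂ), iteratedDeriv m (fun z => Q.eval z) =
        fun z => ((Polynomial.derivative^[m]) Q).eval z := by
      intro m
      induction m with
      | zero => intro Q; simp
      | succ m ih =>
        intro Q
        rw [iteratedDeriv_succ', Function.iterate_succ_apply, ← ih]
        congr 1
        funext z
        exact Q.deriv
    rw [this]
    beta_reduce
    rw [← Polynomial.coeff_zero_eq_eval_zero, Polynomial.coeff_iterate_derivative]
    simp [Nat.descFactorial_self]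
  have hC := Complex.norm_iteratedDeriv_le_of_forall_mem_sphere_norm_le k hρ
    (f := fun z => P.eval z) (c := 0) (C := B) P.differentiable.diffContOnCl
    (fun z hz => by rw [hP]; exact hbd z hz)
  rw [hder, norm_mul, Complex.norm_natCast, mul_div_assoc] at hC
  exact le_of_mul_le_mul_left hC (by positivity)

end BinaryForms

/-! ### Sup norm of the mixed parts of a polynomial on the cube. -/

section Polarization

variable {ι : Type} [Fintype ι] [DecidableEq ι]

/-- The weights are the product distribution of independent signs with means `y i`. -/
lemma prod_eq_sum_walsh (S : Finset ι) (y : ι → ℝ) :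
    ∏ i ∈ S, (y i : ℂ) =
      ∑ x : ι → ℤˣ, ((∏ i, ((1 + ((x i : ℤˣ) : ℤ) * y i) / 2) : ℝ) : ℂ) * walsh S x := by
  have h : ∀ x : ι → ℤˣ, ((∏ i, ((1 + ((x i : ℤˣ) : ℤ) * y i) / 2) : ℝ) : ℂ) * walsh S x =
      ∏ i, ((1 + (((x i : ℤˣ) : ℤ) : ℂ) * y i) / 2 *
        if i ∈ S then (((x i : ℤˣ) : ℤ) : ℂ) else 1) := fun x => by
    rw [Finset.prod_mul_distrib, walsh, Finset.prod_ite_mem, Finset.univ_inter]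
    push_cast
    rfl
  simp only [h]
  rw [← Fintype.prod_sum fun i (e : ℤˣ) => (1 + ((e : ℤ) : ℂ) * y i) / 2 *
    if i ∈ S then ((e : ℤ) : ℂ) else 1]
  rw [← Finset.univ_inter S, ← Finset.prod_ite_mem, Finset.univ_inter]
  refine Finset.prod_congr rfl fun i _ => ?_
  rw [UnitsInt.univ, Finset.sum_pair (by decide)]
  split_ifs <;> simp <;> ring

/-- A multiaffine polynomial attains its maximum over the solid cube at a vertex. -/
lemma norm_sum_mul_prod_le {F : Finset ι → ℂ} {M : ℝ} (hM : ∀ x, ‖walshPoly F x‖ ≤ M)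
    {y : ι → ℝ} (hy : ∀ i, |y i| ≤ 1) : ‖∑ S, F S * ∏ i ∈ S, (y i : ℂ)‖ ≤ M := by
  set W : (ι → ℤˣ) → ℝ := fun x => ∏ i, ((1 + ((x i : ℤˣ) : ℤ) * y i) / 2)
  have hW : ∀ x, 0 ≤ W x := fun x => Finset.prod_nonneg fun i _ => by
    have := abs_le.mp (hy i)
    rcases Int.units_eq_one_or (x i) with h1 | h1 <;> rw [h1] <;> push_cast <;> linarith
  have hW1 : ∑ x, W x = 1 := by
    have := prod_eq_sum_walsh ∅ y
    simp only [Finset.prod_empty, walsh, mul_one] at this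
    exact_mod_cast this.symm
  have h : ∑ S, F S * ∏ i ∈ S, (y i : ℂ) = ∑ x, (W x : ℂ) * walshPoly F x := by
    simp only [walshPoly, prod_eq_sum_walsh, Finset.mul_sum]
    rw [Finset.sum_comm]
    refine Finset.sum_congr rfl fun x _ => Finset.sum_congr rfl fun S _ => ?_
    ring
  rw [h]
  calc _ ≤ ∑ x, ‖(W x : ℂ) * walshPoly F x‖ := norm_sum_le _ _
    _ ≤ ∑ x, W x * M := by
      refine Finset.sum_le_sum fun x _ => ?_
      rw [norm_mul, Complex.norm_real, Real.norm_of_nonneg (hW x)]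
      exact mul_le_mul_of_nonneg_left (hM x) (hW x)
    _ = M := by rw [← Finset.sum_mul, hW1, one_mul]

/-- The part of degree `k` in `u` of the Walsh polynomial `P` at `u + v`. -/
def mixedPart (F : Finset ι → ℂ) (k : ℕ) (u v : ι → ℤˣ) : ℂ :=
  ∑ S, F S * ∑ A ∈ S.powersetCard k, walsh A u * walsh (S \ A) v

lemma sum_mul_prod_add_eq_binForm {F : Finset ι → ℂ} {d : ℕ} (hF : ∀ S, F S ≠ 0 → S.card = d)
    (u v : ι → ℤˣ) (s t : ℝ) :
    ∑ S, F S * ∏ i ∈ S, ((s * ((u i : ℤˣ) : ℤ) + t * ((v i : ℤˣ) : ℤ) : ℝ) : ℂ) =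
      binForm (fun k => mixedPart F k u v) d s t := by
  simp only [binForm, mixedPart, Finset.sum_mul]
  rw [Finset.sum_comm]
  refine Finset.sum_congr rfl fun S _ => ?_
  by_cases hS : F S = 0
  · simp [hS]
  push_cast
  rw [Finset.prod_add, Finset.sum_powerset, hF S hS, Finset.mul_sum]
  refine Finset.sum_congr rfl fun j _ => ?_
  rw [Finset.mul_sum, Finset.mul_sum, Finset.sum_mul, Finset.sum_mul]
  refine Finset.sum_congr rfl fun A hA => ?_
  obtain ⟨hAS, hAj⟩ := Finset.mem_powersetCard.mp hA
  rw [Finset.prod_mul_distrib, Finset.prod_mul_distrib, Finset.prod_const, Finset.prod_const,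
    Finset.card_sdiff_of_subset hAS, hAj, hF S hS]
  simp only [walsh]
  ring

/-- The points `su + tv` with `|s| + |t| ≤ 1` lie in the solid cube. For `ρ` of order `(k/d)^(1/a)`
the exponential is only `e^(O(k))`, so the cost is about `(d/k)^(k/a)`, with `a` as close to `1` as
desired. -/
theorem exists_norm_mixedPart_le {a : ℝ} (ha0 : 0 < a) (ha1 : a < 1) :
    ∃ K : ℝ, 0 < K ∧ ∀ (ι : Type) [Fintype ι] [DecidableEq ι] (d : ℕ) (F : Finset ι → ℂ) (M : ℝ),
      (∀ S, F S ≠ 0 → S.card = d) → (∀ x, ‖walshPoly F x‖ ≤ M) →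
      ∀ ρ : ℝ, 0 < ρ → ρ ≤ 1 / 2 → ∀ k ≤ d, ∀ u v,
        ‖mixedPart F k u v‖ ≤ M * Real.exp (K * d * ρ ^ a) / ρ ^ k := by
  obtain ⟨K, hK, h⟩ := norm_coeff_le_of_norm_binForm_le ha0 ha1
  refine ⟨K, hK, fun ι _ _ d F M hF hM ρ hρ hρ2 k hk u v => ?_⟩
  refine h d (fun k => mixedPart F k u v) M (fun s t hst => ?_) ρ hρ hρ2 k hk
  rw [← sum_mul_prod_add_eq_binForm hF]
  refine norm_sum_mul_prod_le hM fun i => (abs_add_le _ _).trans ?_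
  rw [abs_mul, abs_mul]
  rcases Int.units_eq_one_or (u i) with h1 | h1 <;> rcases Int.units_eq_one_or (v i) with h2 | h2 <;>
    simpa [h1, h2] using hst

/-- The coefficients of the Walsh polynomial that multiplies the Walsh function of `A`. -/
def slice (F : Finset ι → ℂ) (A B : Finset ι) : ℂ := if Disjoint A B then F (A ∪ B) else 0

lemma card_of_slice_ne_zero {F : Finset ι → ℂ} {d : ℕ} (hF : ∀ S, F S ≠ 0 → S.card = d)
    (A B : Finset ι) (h : slice F A B ≠ 0) : B.card = d - A.card := by
  unfold slice at h
  split_ifs at h with hd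
  · have := hF _ h
    rw [Finset.card_union_of_disjoint hd] at this
    omega
  · exact absurd rfl h

/-- `B ↦ A ∪ B` is a bijection from the sets disjoint from `A` onto the supersets of `A`. -/
lemma sum_slice {R : Type*} [AddCommMonoid R] (F : Finset ι → ℂ) (A : Finset ι)
    (φ : Finset ι → ℂ → R) (hφ : ∀ B, φ B 0 = 0) :
    ∑ B, φ B (slice F A B) = ∑ S with A ⊆ S, φ (S \ A) (F S) := by
  have h : ∀ B, φ B (slice F A B) = if Disjoint A B then φ B (F (A ∪ B)) else 0 := fun B => by
    unfold slice
    split_ifs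
    · rfl
    · exact hφ B
  simp only [h]
  rw [← Finset.sum_filter]
  refine Finset.sum_nbij' (fun B => A ∪ B) (fun S => S \ A) ?_ ?_ ?_ ?_ ?_
  · intro B _
    simp
  · intro S _
    simpa using Finset.disjoint_sdiff
  · intro B hB
    exact Finset.union_sdiff_cancel_left (Finset.mem_filter.mp hB).2
  · intro S hS
    exact Finset.union_sdiff_of_subset (Finset.mem_filter.mp hS).2
  · intro B hB
    rw [Finset.union_sdiff_cancel_left (Finset.mem_filter.mp hB).2]

/-- The mixed part as a Walsh polynomial in its first argument. -/
lemma mixedPart_eq_walshPoly (F : Finset ι → ℂ) (k : ℕ) (u v : ι → ℤˣ) :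
    mixedPart F k u v =
      walshPoly (fun A => if A.card = k then walshPoly (slice F A) v else 0) u := by
  have h : ∀ A, walshPoly (slice F A) v = ∑ S with A ⊆ S, F S * walsh (S \ A) v := fun A =>
    sum_slice F A (fun B z => z * walsh B v) fun B => zero_mul _
  simp only [walshPoly, mixedPart] at h ⊢
  simp only [h, Finset.mul_sum, ite_mul, zero_mul, Finset.sum_mul]
  rw [← Finset.sum_filter]
  rw [Finset.sum_sigma', Finset.sum_sigma']
  refine Finset.sum_nbij' (fun p => ⟨p.2, p.1⟩) (fun p => ⟨p.2, p.1⟩) ?_ ?_ ?_ ?_ ?_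
  · rintro ⟨S, A⟩ h
    simpa [Finset.mem_powersetCard, and_comm] using h
  · rintro ⟨A, S⟩ h
    simpa [Finset.mem_powersetCard, and_comm] using h
  · rintro ⟨S, A⟩ _
    rfl
  · rintro ⟨A, S⟩ _
    rfl
  · rintro ⟨S, A⟩ _
    simp only
    ring

end Polarization

/-! ### Blei's inequality with one distinguished variable. -/

section Blei

variable {ι : Type} [Fintype ι] [DecidableEq ι]

lemma sum_powersetCard_prod_le {b : ι → ℝ} (hb : ∀ i, 0 ≤ b i) (T : Finset ι) (k : ℕ) :
    ∑ S ∈ T.powersetCard k, ∏ i ∈ S, b i ≤ (∑ i ∈ T, b i) ^ k := by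
  induction T using Finset.induction_on generalizing k with
  | empty =>
    cases k with
    | zero => simp
    | succ k => rw [Finset.powersetCard_eq_empty.mpr (by simp)]; simp
  | insert j T hj ih =>
    have hT : 0 ≤ ∑ i ∈ T, b i := Finset.sum_nonneg fun i _ => hb i
    cases k with
    | zero => simp
    | succ k =>
      rw [Finset.powersetCard_succ_insert hj, Finset.sum_union, Finset.sum_image,
        Finset.sum_insert hj]
      · have h : ∑ S ∈ T.powersetCard k, ∏ i ∈ insert j S, b i =
            b j * ∑ S ∈ T.powersetCard k, ∏ i ∈ S, b i := by
          rw [Finset.mul_sum]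
          refine Finset.sum_congr rfl fun S hS => Finset.prod_insert fun h => hj ?_
          exact (Finset.mem_powersetCard.mp hS).1 h
        rw [h]
        calc _ ≤ (∑ i ∈ T, b i) ^ (k + 1) + b j * (∑ i ∈ T, b i) ^ k :=
              add_le_add (ih _) (mul_le_mul_of_nonneg_left (ih _) (hb j))
          _ = (b j + ∑ i ∈ T, b i) * (∑ i ∈ T, b i) ^ k := by ring
          _ ≤ (b j + ∑ i ∈ T, b i) * (b j + ∑ i ∈ T, b i) ^ k := by
            have := hb j
            gcongr
            linarith
          _ = _ := by ring
      · intro S hS S' hS' h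
        have h1 : j ∉ S := fun h => hj ((Finset.mem_powersetCard.mp hS).1 h)
        have h2 : j ∉ S' := fun h => hj ((Finset.mem_powersetCard.mp hS').1 h)
        rw [← Finset.erase_insert h1, ← Finset.erase_insert h2, h]
      · rw [Finset.disjoint_left]
        intro S hS hS'
        obtain ⟨S', _, rfl⟩ := Finset.mem_image.mp hS'
        exact hj ((Finset.mem_powersetCard.mp hS).1 (Finset.mem_insert_self _ _))

/-- Blei's inequality for families indexed by sets. -/
theorem sum_norm_rpow_le_sum_sqrt_rpow {k : ℕ} (hk : 1 ≤ k) {F : Finset ι → ℂ}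
    (hF : ∀ S, F S ≠ 0 → S.card = k) :
    ∑ S, ‖F S‖ ^ ((2 * k : ℝ) / (k + 1)) ≤
      (∑ j, Real.sqrt (∑ S with j ∈ S, ‖F S‖ ^ 2)) ^ ((2 * k : ℝ) / (k + 1)) := by
  have hk0 : (0 : ℝ) < k := by exact_mod_cast hk
  set b : ι → ℝ := fun j => Real.sqrt (∑ S with j ∈ S, ‖F S‖ ^ 2)
  have hb : ∀ j, 0 ≤ b j := fun j => Real.sqrt_nonneg _
  have hb2 : ∀ j, b j ^ 2 = ∑ S with j ∈ S, ‖F S‖ ^ 2 := fun j => Real.sq_sqrt (by positivity)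
  have hbpos : ∀ S, F S ≠ 0 → ∀ j ∈ S, 0 < b j := fun S hS j hj => by
    refine Real.sqrt_pos.mpr (Finset.sum_pos' (fun _ _ => by positivity) ⟨S, ?_, ?_⟩)
    · simpa using hj
    · positivity
  set B := ∑ j, b j
  have hB : 0 ≤ B := Finset.sum_nonneg fun j _ => hb j
  set w : Finset ι → ℝ := fun S => ∏ j ∈ S, b j
  have hw : ∀ S, 0 ≤ w S := fun S => Finset.prod_nonneg fun j _ => hb j
  have hconj : (((k : ℝ) + 1) / k).HolderConjugate (k + 1) := by
    rw [Real.holderConjugate_iff]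
    constructor
    · rw [lt_div_iff₀ hk0]
      linarith
    · field_simp
  have hsub : ∑ S, ‖F S‖ ^ ((2 * k : ℝ) / (k + 1)) =
      ∑ S ∈ Finset.univ.powersetCard k, ‖F S‖ ^ ((2 * k : ℝ) / (k + 1)) := by
    refine (Finset.sum_subset (Finset.subset_univ _) fun S _ hS => ?_).symm
    have : F S = 0 := by
      by_contra h
      exact hS (Finset.mem_powersetCard.mpr ⟨Finset.subset_univ _, hF S h⟩)
    rw [this, norm_zero, Real.zero_rpow (by positivity)]
  -- Hölder with weight `w S = ∏ b j`: `∑ w` is at most `B ^ k`, while `∑ ‖F S‖² w^(-1/k)` is at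
  -- most `B` because the geometric mean of the `1 / b j` over `S` is at most their sum. Each factor
  -- then contributes `B^(k/(k+1))`.
  have hH := Real.inner_le_Lp_mul_Lq_of_nonneg (s := Finset.univ.powersetCard k)
    (f := fun S => (‖F S‖ ^ 2 * w S ^ (-(1 / k) : ℝ)) ^ ((k : ℝ) / (k + 1)))
    (g := fun S => w S ^ ((1 : ℝ) / (k + 1))) hconj
    (fun S _ => by have := hw S; positivity) (fun S _ => by have := hw S; positivity)
  have e1 : ∀ S, (‖F S‖ ^ 2 * w S ^ (-(1 / k) : ℝ)) ^ ((k : ℝ) / (k + 1)) *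
      w S ^ ((1 : ℝ) / (k + 1)) = ‖F S‖ ^ ((2 * k : ℝ) / (k + 1)) := fun S => by
    by_cases hS : F S = 0
    · rw [hS, norm_zero, Real.zero_rpow (by positivity), zero_pow two_ne_zero, zero_mul,
        Real.zero_rpow (by positivity), zero_mul]
    · have hwS : 0 < w S := Finset.prod_pos (hbpos S hS)
      rw [Real.mul_rpow (by positivity) (by positivity), ← Real.rpow_mul hwS.le, mul_assoc,
        ← Real.rpow_add hwS, ← Real.rpow_natCast, ← Real.rpow_mul (norm_nonneg _),
        show -(1 / (k : ℝ)) * (k / (k + 1)) + 1 / (k + 1) = 0 by field_simp; ring, Real.rpow_zero,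
        mul_one]
      congr 1
      push_cast
      ring
  have e2 : ∀ S, ((‖F S‖ ^ 2 * w S ^ (-(1 / k) : ℝ)) ^ ((k : ℝ) / (k + 1))) ^ (((k : ℝ) + 1) / k) =
      ‖F S‖ ^ 2 * w S ^ (-(1 / k) : ℝ) := fun S => by
    have := hw S
    rw [← Real.rpow_mul (by positivity), div_mul_div_cancel₀ (by positivity), div_self hk0.ne',
      Real.rpow_one]
  have e3 : ∀ S, (w S ^ ((1 : ℝ) / (k + 1))) ^ ((k : ℝ) + 1) = w S := fun S => by
    rw [← Real.rpow_mul (hw S), one_div_mul_cancel (by positivity), Real.rpow_one]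
  simp only [e1, e2, e3] at hH
  have h1 : ∑ S ∈ Finset.univ.powersetCard k, ‖F S‖ ^ 2 * w S ^ (-(1 / k) : ℝ) ≤ B := by
    calc _ ≤ ∑ S ∈ Finset.univ.powersetCard k, ∑ j ∈ S, ‖F S‖ ^ 2 * (b j)⁻¹ := by
          refine Finset.sum_le_sum fun S hS => ?_
          rw [← Finset.mul_sum]
          refine mul_le_mul_of_nonneg_left ?_ (by positivity)
          have hc := (Finset.mem_powersetCard.mp hS).2
          have hgm := Real.geom_mean_le_arith_mean_weighted S (fun _ => 1 / (k : ℝ))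
            (fun j => (b j)⁻¹) (fun j _ => by positivity)
            (by rw [Finset.sum_const, hc, nsmul_eq_mul]; field_simp)
            (fun j _ => inv_nonneg.mpr (hb j))
          have e : w S ^ (-(1 / k) : ℝ) = ∏ j ∈ S, (b j)⁻¹ ^ (1 / (k : ℝ)) := by
            rw [Real.rpow_neg (hw S), ← Real.inv_rpow (hw S), ← Finset.prod_inv_distrib,
              Real.finsetProd_rpow _ _ fun j _ => inv_nonneg.mpr (hb j)]
          rw [e]
          refine hgm.trans (Finset.sum_le_sum fun j _ => ?_)
          refine mul_le_of_le_one_left (inv_nonneg.mpr (hb j)) ?_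
          rw [div_le_one hk0]
          exact_mod_cast hk
      _ ≤ ∑ S, ∑ j ∈ S, ‖F S‖ ^ 2 * (b j)⁻¹ :=
          Finset.sum_le_sum_of_subset_of_nonneg (Finset.subset_univ _) fun S _ _ =>
            Finset.sum_nonneg fun j _ => by have := hb j; positivity
      _ = ∑ j, ∑ S with j ∈ S, ‖F S‖ ^ 2 * (b j)⁻¹ := by
          refine Finset.sum_comm' fun S j => ?_
          simp
      _ = B := by
          refine Finset.sum_congr rfl fun j _ => ?_
          rw [← Finset.sum_mul, ← hb2, pow_two, mul_self_mul_inv]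
  have h2 := sum_powersetCard_prod_le hb Finset.univ k
  rw [hsub]
  refine hH.trans ?_
  calc _ ≤ B ^ (1 / (((k : ℝ) + 1) / k)) * (B ^ k) ^ (1 / ((k : ℝ) + 1)) := by
        gcongr
    _ = _ := by
        rw [← Real.rpow_natCast, ← Real.rpow_mul hB, ← Real.rpow_add_of_nonneg hB (by positivity)
          (by positivity)]
        congr 1
        field_simp
        norm_num

end Blei

/-! ### Bohnenblust-Hille inequality and mixed-norm estimate. -/

section BohnenblustHille

variable {ι : Type} [Fintype ι] [DecidableEq ι]

/-- Signs are matched to the real and to the imaginary parts separately, whence the factor `2`. -/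
lemma sum_norm_le_two_mul {z : ι → ℂ} {R : ℝ}
    (h : ∀ u : ι → ℤˣ, ‖∑ j, (((u j : ℤˣ) : ℤ) : ℂ) * z j‖ ≤ R) : ∑ j, ‖z j‖ ≤ 2 * R := by
  have key : ∀ y : ι → ℝ, ∃ u : ι → ℤˣ, ∀ j, (((u j : ℤˣ) : ℤ) : ℝ) * y j = |y j| := fun y => by
    refine ⟨fun j => if 0 ≤ y j then 1 else -1, fun j => ?_⟩
    beta_reduce
    split_ifs with hj
    · simp [abs_of_nonneg hj]
    · simp [abs_of_neg (not_le.mp hj)]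
  obtain ⟨u, hu⟩ := key fun j => (z j).re
  obtain ⟨v, hv⟩ := key fun j => (z j).im
  have hre : ∑ j, |(z j).re| ≤ R := by
    refine le_trans (le_of_eq ?_) ((Complex.re_le_norm _).trans (h u))
    rw [Complex.re_sum]
    refine Finset.sum_congr rfl fun j _ => ?_
    rw [← hu, ← Complex.ofReal_intCast, Complex.re_ofReal_mul]
  have him : ∑ j, |(z j).im| ≤ R := by
    refine le_trans (le_of_eq ?_) ((Complex.im_le_norm _).trans (h v))
    rw [Complex.im_sum]
    refine Finset.sum_congr rfl fun j _ => ?_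
    rw [← hv, ← Complex.ofReal_intCast, Complex.im_ofReal_mul]
  calc ∑ j, ‖z j‖ ≤ ∑ j, (|(z j).re| + |(z j).im|) :=
        Finset.sum_le_sum fun j _ => Complex.norm_le_abs_re_add_abs_im _
    _ ≤ 2 * R := by
      rw [Finset.sum_add_distrib]
      linarith

lemma powersetCard_univ_eq_filter (k : ℕ) :
    Finset.powersetCard k (Finset.univ : Finset ι) = Finset.univ.filter fun A => A.card = k := by
  ext A
  simp [Finset.mem_powersetCard]

lemma mixedPart_one (F : Finset ι → ℂ) (u v : ι → ℤˣ) :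
    mixedPart F 1 u v = ∑ j, (((u j : ℤˣ) : ℤ) : ℂ) * walshPoly (slice F {j}) v := by
  rw [mixedPart_eq_walshPoly]
  rw [walshPoly]
  simp only [ite_mul, zero_mul]
  rw [← Finset.sum_filter, ← powersetCard_univ_eq_filter, Finset.powersetCard_one,
    Finset.sum_map]
  refine Finset.sum_congr rfl fun j _ => ?_
  simp [walsh, mul_comm]

/-- The Bohnenblust-Hille inequality on the Boolean cube, with an exponential constant. -/
theorem exists_sum_norm_rpow_le : ∃ C : ℝ, 1 ≤ C ∧
    ∀ (ι : Type) [Fintype ι] [DecidableEq ι] (k : ℕ) (F : Finset ι → ℂ) (M : ℝ), 1 ≤ k →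
      (∀ S, F S ≠ 0 → S.card = k) → (∀ x, ‖walshPoly F x‖ ≤ M) →
      ∑ S, ‖F S‖ ^ ((2 * k : ℝ) / (k + 1)) ≤ (C ^ k * M) ^ ((2 * k : ℝ) / (k + 1)) := by
  obtain ⟨K, hK, h⟩ := exists_norm_mixedPart_le (a := 20 / 21) (by norm_num) (by norm_num)
  have hexp : 1 ≤ Real.exp K := Real.one_le_exp hK.le
  refine ⟨12 * Real.exp K, by linarith, fun ι _ _ k F M hk hF hM => ?_⟩
  have hM0 : 0 ≤ M := (norm_nonneg _).trans (hM 1)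
  refine (sum_norm_rpow_le_sum_sqrt_rpow hk hF).trans ?_
  refine Real.rpow_le_rpow (Finset.sum_nonneg fun _ _ => Real.sqrt_nonneg _) ?_ (by positivity)
  set N : ℝ := ((Fintype.card (ι → ℤˣ) : ℕ) : ℝ) with hN_def
  have hN : 0 < N := Nat.cast_pos.mpr Fintype.card_pos
  have hj : ∀ j, N * Real.sqrt (∑ S with j ∈ S, ‖F S‖ ^ 2) ≤
      3 ^ (k - 1) * ∑ v, ‖walshPoly (slice F {j}) v‖ := fun j => by
    have h1 := card_mul_sum_norm_sq_rpow_le (k - 1) (slice F {j})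
      (fun B hB => by simpa using card_of_slice_ne_zero hF {j} B hB) one_pos one_lt_two
    have h2 : ∑ B, ‖slice F {j} B‖ ^ 2 = ∑ S with j ∈ S, ‖F S‖ ^ 2 := by
      rw [sum_slice F {j} (fun _ z => ‖z‖ ^ 2) (by simp)]
      simp only [Finset.singleton_subset_iff]
    rw [h2, ← Real.sqrt_eq_rpow, show (2 : ℝ) - 1 = 1 by norm_num, mul_one,
      Real.rpow_natCast] at h1
    simpa only [Real.rpow_one] using h1
  -- The mixed part of degree one is linear in `u`. As an exponential constant is enough here, `ρ =
  -- 1/2` suffices.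
  have hv : ∀ v, ∑ j, ‖walshPoly (slice F {j}) v‖ ≤ 4 * Real.exp K ^ k * M := fun v => by
    refine (sum_norm_le_two_mul (R := 2 * Real.exp K ^ k * M) fun u => ?_).trans_eq (by ring)
    rw [← mixedPart_one]
    refine (h ι k F M hF hM (1 / 2) (by norm_num) le_rfl 1 hk u v).trans ?_
    rw [← Real.exp_nat_mul]
    have h3 : Real.exp (K * k * (1 / 2) ^ (20 / 21 : ℝ)) ≤ Real.exp (k * K) := by
      apply Real.exp_le_exp.mpr
      rw [mul_comm K]
      refine mul_le_of_le_one_right (by positivity) ?_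
      exact Real.rpow_le_one (by norm_num) (by norm_num) (by norm_num)
    calc _ ≤ M * Real.exp (k * K) / (1 / 2) ^ 1 := by gcongr
      _ = _ := by ring
  refine le_of_mul_le_mul_left ?_ hN
  calc N * ∑ j, Real.sqrt (∑ S with j ∈ S, ‖F S‖ ^ 2)
      ≤ ∑ j, 3 ^ (k - 1) * ∑ v, ‖walshPoly (slice F {j}) v‖ := by
        rw [Finset.mul_sum]
        exact Finset.sum_le_sum fun j _ => hj j
    _ = 3 ^ (k - 1) * ∑ v, ∑ j, ‖walshPoly (slice F {j}) v‖ := by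
        rw [← Finset.mul_sum, Finset.sum_comm]
    _ ≤ 3 ^ (k - 1) * (N * (4 * Real.exp K ^ k * M)) := by
        gcongr
        refine (Finset.sum_le_sum fun v _ => hv v).trans_eq ?_
        rw [Finset.sum_const, nsmul_eq_mul, Finset.card_univ]
    _ = N * (3 ^ (k - 1) * 4 * Real.exp K ^ k * M) := by ring
    _ ≤ _ := by
        rw [mul_pow]
        gcongr
        obtain ⟨m, rfl⟩ := Nat.exists_eq_add_of_le' hk
        rw [Nat.add_sub_cancel, pow_succ]
        have : (3 : ℝ) ^ m ≤ 12 ^ m := by gcongr; norm_num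
        nlinarith [pow_pos (show (0 : ℝ) < 12 by norm_num) m]

/-- The mixed-norm estimate for the coefficients of a Walsh polynomial whose mixed parts are
bounded. -/
theorem sum_powersetCard_slice_rpow_le {k d : ℕ} (hk : 1 ≤ k) {C R : ℝ}
    (hC : ∀ G : Finset ι → ℂ, (∀ S, G S ≠ 0 → S.card = k) → (∀ x, ‖walshPoly G x‖ ≤ R) →
      ∑ S, ‖G S‖ ^ ((2 * k : ℝ) / (k + 1)) ≤ C)
    {F : Finset ι → ℂ} (hF : ∀ S, F S ≠ 0 → S.card = d)
    (hR : ∀ u v, ‖mixedPart F k u v‖ ≤ R) :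
    ∑ A ∈ Finset.univ.powersetCard k,
      (∑ B, ‖slice F A B‖ ^ 2) ^ ((1 / 2 : ℝ) * ((2 * k : ℝ) / (k + 1))) ≤
      3 ^ (((d - k : ℕ) : ℝ) * (2 / (k + 1))) * C := by
  have hk0 : (0 : ℝ) < k := by exact_mod_cast hk
  set N : ℝ := ((Fintype.card (ι → ℤˣ) : ℕ) : ℝ) with hN_def
  have hN : 0 < N := Nat.cast_pos.mpr Fintype.card_pos
  set p : ℝ := (2 * k : ℝ) / (k + 1)
  have hp0 : 0 < p := by positivity
  have hp2 : 2 - p = 2 / (k + 1) := by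
    simp only [p]
    field_simp
    ring
  have hp2' : p < 2 := by
    have : 0 < 2 - p := by rw [hp2]; positivity
    linarith
  have hA : ∀ A ∈ Finset.univ.powersetCard k, N * (∑ B, ‖slice F A B‖ ^ 2) ^ (1 / 2 * p) ≤
      3 ^ (((d - k : ℕ) : ℝ) * (2 / (k + 1))) * ∑ v, ‖walshPoly (slice F A) v‖ ^ p := by
    intro A hA
    have hc := (Finset.mem_powersetCard.mp hA).2
    have h1 := card_mul_sum_norm_sq_rpow_le (d - k) (slice F A)
      (fun B hB => hc ▸ card_of_slice_ne_zero hF A B hB) hp0 hp2'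
    rw [hp2] at h1
    rwa [one_div_mul_eq_div]
  -- For fixed `v` the slice values are the coefficients of a `k`-homogeneous polynomial in `u`,
  -- namely the mixed part, so `hC` applies to them.
  have hv : ∀ v, ∑ A ∈ Finset.univ.powersetCard k, ‖walshPoly (slice F A) v‖ ^ p ≤ C := fun v => by
    refine le_trans (le_of_eq ?_) (hC (fun A => if A.card = k then walshPoly (slice F A) v else 0)
      (fun S hS => by
        by_contra h
        exact hS (if_neg h))
      fun u => by
        rw [← mixedPart_eq_walshPoly]
        exact hR u v)
    rw [powersetCard_univ_eq_filter, Finset.sum_filter]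
    refine Finset.sum_congr rfl fun A _ => ?_
    split_ifs
    · rfl
    · rw [norm_zero, Real.zero_rpow hp0.ne']
  refine le_of_mul_le_mul_left ?_ hN
  rw [Finset.mul_sum]
  refine (Finset.sum_le_sum hA).trans ?_
  rw [← Finset.mul_sum, Finset.sum_comm, mul_left_comm]
  gcongr
  refine (Finset.sum_le_sum fun v _ => hv v).trans_eq ?_
  rw [Finset.sum_const, nsmul_eq_mul, Finset.card_univ]

end BohnenblustHille

/-! ### From increasing maps and scalars in `𝕜` to finite sets and complex scalars. -/

section Transfer

variable {𝕜 : Type*} [RCLike 𝕜] {ι : Type} [LinearOrder ι] [Fintype ι] {d n : ℕ}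

/-- The range of an increasing map, as a finite set. -/
def rangeSet (i : ι ↪o Fin n) : Finset (Fin n) := Finset.univ.map i.toEmbedding

lemma card_rangeSet (i : ι ↪o Fin n) : (rangeSet i).card = Fintype.card ι := by
  simp [rangeSet]

lemma mem_rangeSet {i : ι ↪o Fin n} {x : Fin n} : x ∈ rangeSet i ↔ ∃ s, i s = x := by
  simp [rangeSet]

lemma rangeSet_injective : Function.Injective (rangeSet : (ι ↪o Fin n) → Finset (Fin n)) := by
  intro i j h
  rw [← OrderEmbedding.range_inj]
  ext x
  simpa only [mem_rangeSet, Set.mem_range] using Finset.ext_iff.mp h x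

lemma exists_rangeSet_eq {S : Finset (Fin n)} (hS : S.card = Fintype.card ι) :
    ∃ i : ι ↪o Fin n, rangeSet i = S := by
  refine ⟨((Fintype.orderIsoFinOfCardEq ι rfl).symm.toOrderEmbedding).trans
    (S.orderEmbOfFin hS), ?_⟩
  apply Finset.eq_of_subset_of_card_le
  · intro x hx
    obtain ⟨s, rfl⟩ := mem_rangeSet.mp hx
    exact S.orderEmbOfFin_mem hS _
  · rw [hS, card_rangeSet]

lemma card_filter_rangeSet_subset (W : Finset (Fin n)) :
    (Finset.univ.filter fun i : ι ↪o Fin n => rangeSet i ⊆ W).card =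
      W.card.choose (Fintype.card ι) := by
  rw [← Finset.card_powersetCard, ← Finset.card_image_of_injective _ rangeSet_injective]
  congr 1
  ext S
  simp only [Finset.mem_image, Finset.mem_filter, Finset.mem_univ, true_and,
    Finset.mem_powersetCard]
  constructor
  · rintro ⟨i, hi, rfl⟩
    exact ⟨hi, card_rangeSet i⟩
  · rintro ⟨hSW, hS⟩
    obtain ⟨i, rfl⟩ := exists_rangeSet_eq hS
    exact ⟨i, hSW, rfl⟩

lemma card_orderEmbedding : Fintype.card (ι ↪o Fin n) = n.choose (Fintype.card ι) := by
  have := card_filter_rangeSet_subset (ι := ι) (Finset.univ : Finset (Fin n))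
  simpa using this

/-- The family over finite sets that corresponds to a family over increasing maps, with values
in the complex numbers. -/
noncomputable def toFamily (a : IncMap (Fin d) n → 𝕜) (S : Finset (Fin n)) : ℂ :=
  if h : S.card = d then RCLike.map 𝕜 ℂ (a (S.orderEmbOfFin h)) else 0

lemma norm_rclike_map (z : 𝕜) : ‖RCLike.map 𝕜 ℂ z‖ = ‖z‖ := by
  rw [← sq_eq_sq₀ (norm_nonneg _) (norm_nonneg _), RCLike.map_apply, Complex.sq_norm,
    Complex.normSq_apply, ← RCLike.normSq_eq_def', RCLike.normSq_apply]
  simp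

lemma toFamily_rangeSet (a : IncMap (Fin d) n → 𝕜) (i : IncMap (Fin d) n) :
    toFamily a (rangeSet i) = RCLike.map 𝕜 ℂ (a i) := by
  have h : (rangeSet i).card = d := by rw [card_rangeSet, Fintype.card_fin]
  rw [toFamily, dif_pos h,
    ← Finset.orderEmbOfFin_unique' h (f := i) fun s => mem_rangeSet.mpr ⟨s, rfl⟩]

lemma card_of_toFamily_ne_zero (a : IncMap (Fin d) n → 𝕜) (S : Finset (Fin n))
    (h : toFamily a S ≠ 0) : S.card = d := by
  by_contra hS
  exact h (dif_neg hS)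

lemma sum_toFamily {R : Type*} [AddCommMonoid R] (a : IncMap (Fin d) n → 𝕜)
    (φ : Finset (Fin n) → ℂ → R) (hφ : ∀ S, φ S 0 = 0) :
    ∑ S, φ S (toFamily a S) = ∑ i, φ (rangeSet i) (RCLike.map 𝕜 ℂ (a i)) := by
  have h : ∑ S ∈ Finset.univ.map ⟨rangeSet, rangeSet_injective (ι := Fin d) (n := n)⟩,
      φ S (toFamily a S) = ∑ S, φ S (toFamily a S) := by
    refine Finset.sum_subset (Finset.subset_univ _) fun S _ hS => ?_
    have : toFamily a S = 0 := by
      by_contra h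
      obtain ⟨i, hi⟩ := exists_rangeSet_eq (ι := Fin d)
        ((card_of_toFamily_ne_zero a S h).trans (Fintype.card_fin d).symm)
      exact hS (Finset.mem_map.mpr ⟨i, Finset.mem_univ _, hi⟩)
    rw [this, hφ]
  rw [← h, Finset.sum_map]
  simp only [Function.Embedding.coeFn_mk, toFamily_rangeSet]

lemma norm_cubePoly (a : IncMap (Fin d) n → 𝕜) (x : Fin n → ℤˣ) :
    ‖cubePoly a x‖ = ‖walshPoly (toFamily a) x‖ := by
  rw [← norm_rclike_map]
  congr 1
  rw [walshPoly, sum_toFamily a (fun S z => z * walsh S x) (by simp), cubePoly, map_sum]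
  refine Finset.sum_congr rfl fun i _ => ?_
  have h : ∏ s, (((x (i s) : ℤˣ) : ℤ) : 𝕜) = ((∏ s, ((x (i s) : ℤˣ) : ℤ) : ℤ) : 𝕜) := by
    push_cast
    rfl
  rw [h, mul_comm, ← zsmul_eq_mul, map_zsmul, zsmul_eq_mul, mul_comm, walsh, rangeSet,
    Finset.prod_map]
  push_cast
  rfl

lemma norm_walshPoly_le_cubeNorm (a : IncMap (Fin d) n → 𝕜) (x : Fin n → ℤˣ) :
    ‖walshPoly (toFamily a) x‖ ≤ cubeNorm a := by
  rw [← norm_cubePoly]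
  exact le_ciSup (f := fun x => ‖cubePoly a x‖) (Set.finite_range _).bddAbove x

lemma cubeNorm_nonneg (a : IncMap (Fin d) n → 𝕜) : 0 ≤ cubeNorm a :=
  (norm_nonneg _).trans (norm_walshPoly_le_cubeNorm a 1)

lemma sum_norm_toFamily_rpow (a : IncMap (Fin d) n → 𝕜) {p : ℝ} (hp : p ≠ 0) :
    ∑ S, ‖toFamily a S‖ ^ p = ∑ i, ‖a i‖ ^ p := by
  rw [sum_toFamily a (fun _ z => ‖z‖ ^ p) (by simp [Real.zero_rpow hp])]
  simp only [norm_rclike_map]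

/-- The Boolean Bohnenblust-Hille constants grow at most exponentially. -/
theorem exists_BH_le : ∃ C : ℝ, 1 ≤ C ∧
    ∀ (𝕜 : Type*) [RCLike 𝕜] (k : ℕ), 1 ≤ k → BH 𝕜 k ≤ ENNReal.ofReal (C ^ k) := by
  obtain ⟨C, hC, h⟩ := exists_sum_norm_rpow_le
  refine ⟨C, hC, fun 𝕜 _ k hk => sInf_le fun n a => ?_⟩
  have hk0 : (0 : ℝ) < k := by exact_mod_cast hk
  have hM := cubeNorm_nonneg a
  rw [← ENNReal.ofReal_mul (by positivity)]
  apply ENNReal.ofReal_le_ofReal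
  have h1 := h (Fin n) k (toFamily a) (cubeNorm a) hk (card_of_toFamily_ne_zero a)
    (norm_walshPoly_le_cubeNorm a)
  rw [sum_norm_toFamily_rpow a (by positivity)] at h1
  calc coeffNorm a ≤ ((C ^ k * cubeNorm a) ^ ((2 * k : ℝ) / (k + 1))) ^ (((k : ℝ) + 1) / (2 * k)) :=
        Real.rpow_le_rpow (by positivity) h1 (by positivity)
    _ = C ^ k * cubeNorm a := by
        rw [← Real.rpow_mul (by positivity), div_mul_div_cancel₀ (by positivity),
          div_self (by positivity), Real.rpow_one]

/-- The single monomial in `k` variables has both norms equal to `1`. -/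
theorem one_le_BH (𝕜 : Type*) [RCLike 𝕜] (k : ℕ) : 1 ≤ BH 𝕜 k := by
  refine le_sInf fun C hC => ?_
  have h := hC k fun _ => 1
  have hcard : Fintype.card (IncMap (Fin k) k) = 1 := by
    rw [card_orderEmbedding, Fintype.card_fin, Nat.choose_self]
  have h1 : coeffNorm (fun _ : IncMap (Fin k) k => (1 : 𝕜)) = 1 := by
    simp [coeffNorm, hcard]
  have h2 : cubeNorm (fun _ : IncMap (Fin k) k => (1 : 𝕜)) ≤ 1 := by
    refine ciSup_le fun x => ?_
    refine (norm_sum_le _ _).trans ?_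
    have : ∀ e : ℤˣ, ‖((e : ℤ) : 𝕜)‖ = 1 := fun e => by
      rcases Int.units_eq_one_or e with h | h <;> simp [h]
    simp [this, hcard]
  rw [h1, ENNReal.ofReal_one] at h
  calc 1 ≤ C * ENNReal.ofReal _ := h
    _ ≤ C * ENNReal.ofReal 1 := by gcongr
    _ = C := by rw [ENNReal.ofReal_one, mul_one]

end Transfer

/-! ### Binomial inequalities. -/

section Binomials

/-- Consecutive coefficients have ratio `(n - m)/(m + 1)`, and the `m`-th power of this is at most
`C(n, m)`. -/
lemma choose_succ_pow_le (n m : ℕ) (hm : 1 ≤ m) :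
    n.choose (m + 1) ^ m ≤ n.choose m ^ (m + 1) := by
  have h1 : (n - m) ^ m ≤ (m + 1) ^ m * n.choose m := by
    calc (n - m) ^ m ≤ (n + 1 - m) ^ m := Nat.pow_le_pow_left (by omega) _
      _ ≤ n.descFactorial m := Nat.pow_sub_le_descFactorial n m
      _ = m.factorial * n.choose m := Nat.descFactorial_eq_factorial_mul_choose n m
      _ ≤ (m + 1) ^ m * n.choose m := by
        gcongr
        exact (Nat.factorial_le_pow m).trans (Nat.pow_le_pow_left (Nat.le_succ m) m)
  refine Nat.le_of_mul_le_mul_left ?_ (show 0 < (m + 1) ^ m by positivity)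
  calc (m + 1) ^ m * n.choose (m + 1) ^ m = (n.choose (m + 1) * (m + 1)) ^ m := by
        rw [mul_pow, mul_comm]
    _ = n.choose m ^ m * (n - m) ^ m := by rw [Nat.choose_succ_right_eq, mul_pow]
    _ ≤ n.choose m ^ m * ((m + 1) ^ m * n.choose m) := by gcongr
    _ = _ := by ring

/-- The numbers `C(n, m) ^ (1 / m)` decrease in `m`. -/
lemma choose_pow_le_choose_pow (n : ℕ) {k m : ℕ} (hk : 1 ≤ k) (hkm : k ≤ m) :
    n.choose m ^ k ≤ n.choose k ^ m := by
  induction m, hkm using Nat.le_induction with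
  | base => exact le_rfl
  | succ m hm ih =>
    have hm0 : m ≠ 0 := by omega
    rw [← Nat.pow_le_pow_iff_left hm0]
    calc (n.choose (m + 1) ^ k) ^ m = (n.choose (m + 1) ^ m) ^ k := pow_right_comm _ _ _
      _ ≤ (n.choose m ^ (m + 1)) ^ k :=
        Nat.pow_le_pow_left (choose_succ_pow_le n m (by omega)) k
      _ = (n.choose m ^ k) ^ (m + 1) := pow_right_comm _ _ _
      _ ≤ (n.choose k ^ m) ^ (m + 1) := Nat.pow_le_pow_left ih _
      _ = _ := pow_right_comm _ _ _

lemma pow_le_pow_mul_choose (k d : ℕ) (h : k ≤ d) : d ^ k ≤ k ^ k * d.choose k := by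
  induction k generalizing d with
  | zero => simp
  | succ k ih =>
    obtain ⟨d, rfl⟩ := Nat.exists_eq_add_of_le' (show 1 ≤ d by omega)
    have hkd : k ≤ d := by omega
    have h1 : (d + 1) ^ k ≤ (k + 1) ^ k * d.choose k := by
      rcases Nat.eq_zero_or_pos k with rfl | hk
      · simp
      refine Nat.le_of_mul_le_mul_left ?_ (show 0 < k ^ k by positivity)
      calc k ^ k * (d + 1) ^ k = (k * (d + 1)) ^ k := (mul_pow _ _ _).symm
        _ ≤ ((k + 1) * d) ^ k := Nat.pow_le_pow_left (by nlinarith) k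
        _ = (k + 1) ^ k * d ^ k := mul_pow _ _ _
        _ ≤ (k + 1) ^ k * (k ^ k * d.choose k) := by gcongr; exact ih d hkd
        _ = _ := by ring
    calc (d + 1) ^ (k + 1) = (d + 1) * (d + 1) ^ k := pow_succ' _ _
      _ ≤ (d + 1) * ((k + 1) ^ k * d.choose k) := by gcongr
      _ = (k + 1) ^ k * ((d + 1) * d.choose k) := by ring
      _ = (k + 1) ^ (k + 1) * (d + 1).choose (k + 1) := by
        rw [Nat.add_one_mul_choose_eq]
        ring

lemma div_pow_le_choose {k d : ℕ} (hk : 1 ≤ k) (h : k ≤ d) :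
    ((d : ℝ) / k) ^ k ≤ d.choose k := by
  rw [div_pow, div_le_iff₀' (by positivity)]
  exact_mod_cast pow_le_pow_mul_choose k d h

end Binomials

/-! ### The binomial gain and the bound with free `k`. -/

section ConstantModulus

variable {𝕜 : Type*} [RCLike 𝕜] {d n : ℕ}

lemma ConstModulus.exists_norm_eq {a : IncMap (Fin d) n → 𝕜} (ha : ConstModulus a) :
    ∃ c : ℝ, 0 ≤ c ∧ ∀ i, ‖a i‖ = c := by
  rcases isEmpty_or_nonempty (IncMap (Fin d) n) with h | ⟨⟨i⟩⟩
  · exact ⟨0, le_rfl, fun i => h.elim i⟩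
  · exact ⟨‖a i‖, norm_nonneg _, fun j => ha j i⟩

lemma coeffNorm_eq {a : IncMap (Fin d) n → 𝕜} {c : ℝ} (h : ∀ i, ‖a i‖ = c) :
    coeffNorm a =
      (n.choose d * c ^ ((2 * d : ℝ) / (d + 1))) ^ (((d : ℝ) + 1) / (2 * d)) := by
  simp only [coeffNorm, h, Finset.sum_const, nsmul_eq_mul, Finset.card_univ,
    card_orderEmbedding, Fintype.card_fin]

/-- Comparison of the `ℓ`-norm with exponent `2d/(d+1)` and a mixed norm, for a constant family. -/
lemma choose_mul_rpow_le {k : ℕ} (hk : 1 ≤ k) (hkd : k ≤ d) {c : ℝ} (hc : 0 ≤ c) :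
    (n.choose d * c ^ ((2 * d : ℝ) / (d + 1))) ^ (((d : ℝ) + 1) / (2 * d)) ≤
      (d.choose k : ℝ) ^ (-(1 / 2) : ℝ) *
        (n.choose k * ((n - k).choose (d - k) * c ^ 2) ^ ((1 / 2 : ℝ) * ((2 * k : ℝ) / (k + 1)))) ^
          (((k : ℝ) + 1) / (2 * k)) := by
  have hk0 : (0 : ℝ) < k := by exact_mod_cast hk
  have hd0 : (0 : ℝ) < d := by exact_mod_cast hk.trans hkd
  rcases lt_or_ge n d with hn | hn
  · rw [Nat.choose_eq_zero_of_lt hn, Nat.cast_zero, zero_mul, Real.zero_rpow (by positivity)]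
    positivity
  have hX : (0 : ℝ) < n.choose d := by exact_mod_cast Nat.choose_pos hn
  have hY : (0 : ℝ) < n.choose k := by exact_mod_cast Nat.choose_pos (hkd.trans hn)
  have hZ : (0 : ℝ) < d.choose k := by exact_mod_cast Nat.choose_pos hkd
  have hW : (0 : ℝ) < (n - k).choose (d - k) := by
    exact_mod_cast Nat.choose_pos (Nat.sub_le_sub_right hn k)
  have hmul : (n.choose d * d.choose k : ℝ) = n.choose k * (n - k).choose (d - k) := by
    exact_mod_cast Nat.choose_mul hkd
  have hpow : (n.choose d : ℝ) ^ (1 / (2 * d : ℝ)) ≤ (n.choose k : ℝ) ^ (1 / (2 * k : ℝ)) := by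
    have h1 : (n.choose d : ℝ) ^ k ≤ (n.choose k : ℝ) ^ d := by
      exact_mod_cast choose_pow_le_choose_pow n hk hkd
    have h2 := Real.rpow_le_rpow (by positivity) h1 (z := 1 / (2 * k * d : ℝ)) (by positivity)
    rw [← Real.rpow_natCast, ← Real.rpow_natCast, ← Real.rpow_mul hX.le, ← Real.rpow_mul hY.le]
      at h2
    convert h2 using 2 <;> field_simp
  generalize (n.choose d : ℝ) = X at *
  generalize (n.choose k : ℝ) = Y at *
  generalize (d.choose k : ℝ) = Z at *
  generalize ((n - k).choose (d - k) : ℝ) = W at *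
  have hL : (X * c ^ ((2 * d : ℝ) / (d + 1))) ^ (((d : ℝ) + 1) / (2 * d)) =
      X ^ (1 / 2 : ℝ) * X ^ (1 / (2 * d : ℝ)) * c := by
    rw [Real.mul_rpow hX.le (by positivity), ← Real.rpow_mul hc, div_mul_div_cancel₀ (by positivity),
      div_self (by positivity), Real.rpow_one, ← Real.rpow_add hX]
    congr 2
    field_simp
  have hR : (Y * (W * c ^ 2) ^ ((1 / 2 : ℝ) * ((2 * k : ℝ) / (k + 1)))) ^ (((k : ℝ) + 1) / (2 * k)) =
      (Y * W) ^ (1 / 2 : ℝ) * Y ^ (1 / (2 * k : ℝ)) * c := by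
    rw [Real.mul_rpow hY.le (by positivity), ← Real.rpow_mul (by positivity), mul_assoc,
      div_mul_div_cancel₀ (by positivity), div_self (by positivity), mul_one,
      Real.mul_rpow hW.le (by positivity), ← Real.rpow_natCast c, ← Real.rpow_mul hc,
      Real.mul_rpow hY.le hW.le, show (((k : ℝ) + 1) / (2 * k)) = 1 / 2 + 1 / (2 * k) by field_simp,
      Real.rpow_add hY]
    norm_num
    ring
  -- With `Y * W = X * Z`, the factor `Z^(1/2)` is exactly the gain; what is left is `X^(1/(2d)) ≤
  -- Y^(1/(2k))`.
  rw [hL, hR, ← hmul, Real.mul_rpow hX.le hZ.le]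
  have hZ1 : Z ^ (-(1 / 2) : ℝ) * Z ^ (1 / 2 : ℝ) = 1 := by
    rw [← Real.rpow_add hZ]
    norm_num
  calc X ^ (1 / 2 : ℝ) * X ^ (1 / (2 * d : ℝ)) * c ≤ X ^ (1 / 2 : ℝ) * Y ^ (1 / (2 * k : ℝ)) * c := by
        gcongr
    _ = (Z ^ (-(1 / 2) : ℝ) * Z ^ (1 / 2 : ℝ)) * (X ^ (1 / 2 : ℝ) * Y ^ (1 / (2 * k : ℝ)) * c) := by
        rw [hZ1, one_mul]
    _ = _ := by ring

/-- Each half is injective, so only collisions between the two ranges matter. This turns the support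
of `flatCoeff` into a count of subsets of a complement. -/
lemma glue_injective_iff (S : Finset (Fin d)) (i : IncMap S n)
    (j : IncMap (Sᶜ : Finset (Fin d)) n) :
    Function.Injective (glue S i j) ↔ rangeSet i ⊆ (rangeSet j)ᶜ := by
  have hS : ∀ (s) (h : s ∈ S), glue S i j s = i ⟨s, h⟩ := fun s h => dif_pos h
  have hS' : ∀ (s) (h : s ∉ S), glue S i j s = j ⟨s, Finset.mem_compl.mpr h⟩ := fun s h => dif_neg h
  constructor
  · intro h x hx
    rw [Finset.mem_compl]
    intro hx'
    obtain ⟨s, rfl⟩ := mem_rangeSet.mp hx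
    obtain ⟨t, ht⟩ := mem_rangeSet.mp hx'
    have ht' := Finset.mem_compl.mp t.2
    have : t.1 = s.1 := h (by rw [hS _ s.2, hS' _ ht']; exact ht)
    exact ht' (this ▸ s.2)
  · intro h s t hst
    have key : ∀ s t, s ∈ S → t ∉ S → glue S i j s ≠ glue S i j t := fun s t hs ht hst => by
      rw [hS s hs, hS' t ht] at hst
      exact Finset.mem_compl.mp (h (mem_rangeSet.mpr ⟨_, rfl⟩)) (mem_rangeSet.mpr ⟨_, hst.symm⟩)
    by_cases hs : s ∈ S <;> by_cases ht : t ∈ S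
    · rw [hS s hs, hS t ht] at hst
      exact congrArg Subtype.val (i.injective hst)
    · exact absurd hst (key s t hs ht)
    · exact absurd hst.symm (key t s ht hs)
    · rw [hS' s hs, hS' t ht] at hst
      exact congrArg Subtype.val (j.injective hst)

lemma bleiMean_eq {k : ℕ} (hkd : k ≤ d) {a : IncMap (Fin d) n → 𝕜} {c : ℝ}
    (h : ∀ i, ‖a i‖ = c) :
    bleiMean k a =
      (n.choose k * ((n - k).choose (d - k) * c ^ 2) ^ ((1 / 2 : ℝ) * ((2 * k : ℝ) / (k + 1)))) ^
          (((k : ℝ) + 1) / (2 * k)) := by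
  classical
  have hin : ∀ S ∈ Finset.powersetCard (d - k) (Finset.univ : Finset (Fin d)),
      ∀ j : IncMap (Sᶜ : Finset (Fin d)) n,
      ∑ i : IncMap S n, ‖flatCoeff a (glue S i j)‖ ^ 2 = (n - k).choose (d - k) * c ^ 2 := by
    intro S hS j
    have hSc := (Finset.mem_powersetCard.mp hS).2
    have h1 : ∀ i : IncMap S n, ‖flatCoeff a (glue S i j)‖ ^ 2 =
        if rangeSet i ⊆ (rangeSet j)ᶜ then c ^ 2 else 0 := fun i => by
      unfold flatCoeff
      by_cases hi : Function.Injective (glue S i j)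
      · rw [dif_pos hi, if_pos ((glue_injective_iff S i j).mp hi), h]
      · rw [dif_neg hi, if_neg (mt (glue_injective_iff S i j).mpr hi)]
        simp
    simp only [h1]
    rw [← Finset.sum_filter, Finset.sum_const, nsmul_eq_mul, card_filter_rangeSet_subset,
      Finset.card_compl, card_rangeSet, Fintype.card_coe, Fintype.card_coe, Finset.card_compl, hSc,
      Fintype.card_fin, Fintype.card_fin, Nat.sub_sub_self hkd]
  have hout : ∀ S ∈ Finset.powersetCard (d - k) (Finset.univ : Finset (Fin d)),
      (∑ j : IncMap (Sᶜ : Finset (Fin d)) n, (∑ i : IncMap S n, ‖flatCoeff a (glue S i j)‖ ^ 2) ^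
          ((1 / 2 : ℝ) * ((2 * k : ℝ) / (k + 1)))) ^ (((k : ℝ) + 1) / (2 * k)) =
      (n.choose k * ((n - k).choose (d - k) * c ^ 2) ^ ((1 / 2 : ℝ) * ((2 * k : ℝ) / (k + 1)))) ^
          (((k : ℝ) + 1) / (2 * k)) := by
    intro S hS
    have hSc := (Finset.mem_powersetCard.mp hS).2
    rw [Finset.sum_congr rfl fun j _ => by rw [hin S hS j], Finset.sum_const, nsmul_eq_mul,
      Finset.card_univ, card_orderEmbedding, Fintype.card_coe, Finset.card_compl, hSc,
      Fintype.card_fin, Nat.sub_sub_self hkd]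
  rw [bleiMean, Finset.prod_congr rfl hout, Finset.prod_const, Finset.card_powersetCard,
    Finset.card_univ, Fintype.card_fin, Nat.choose_symm hkd]
  have hZ : d.choose k ≠ 0 := (Nat.choose_pos hkd).ne'
  exact Real.pow_rpow_inv_natCast (by positivity) hZ

/-- Blei's inequality with a gain for coefficients of constant modulus. -/
theorem coeffNorm_le_bleiMean {k : ℕ} (hk : 1 ≤ k) (hkd : k ≤ d) {a : IncMap (Fin d) n → 𝕜}
    (ha : ConstModulus a) :
    coeffNorm a ≤ (d.choose k : ℝ) ^ (-(1 / 2) : ℝ) * bleiMean k a := by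
  obtain ⟨c, hc, h⟩ := ha.exists_norm_eq
  rw [coeffNorm_eq h, bleiMean_eq hkd h]
  exact choose_mul_rpow_le hk hkd hc

lemma sum_norm_slice_toFamily_sq {k : ℕ} (hkd : k ≤ d) {a : IncMap (Fin d) n → 𝕜} {c : ℝ}
    (h : ∀ i, ‖a i‖ = c) {A : Finset (Fin n)} (hA : A.card = k) :
    ∑ B, ‖slice (toFamily a) A B‖ ^ 2 = (n - k).choose (d - k) * c ^ 2 := by
  have h1 : ∀ B, ‖slice (toFamily a) A B‖ ^ 2 =
      if B ∈ Aᶜ.powersetCard (d - k) then c ^ 2 else 0 := by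
    intro B
    simp only [Finset.mem_powersetCard, Finset.subset_compl_iff_disjoint_left]
    rw [slice]
    by_cases hd : Disjoint A B
    · have hAB := Finset.card_union_of_disjoint hd
      rw [if_pos hd, toFamily]
      by_cases hB : B.card = d - k
      · rw [dif_pos (by omega), if_pos ⟨hd, hB⟩, norm_rclike_map, h]
      · rw [dif_neg (by omega), if_neg fun h => hB h.2]
        simp
    · rw [if_neg hd, if_neg fun h => hd h.1]
      simp
  simp only [h1]
  rw [Finset.sum_ite_mem, Finset.univ_inter, Finset.sum_const, nsmul_eq_mul,
    Finset.card_powersetCard, Finset.card_compl, hA, Fintype.card_fin]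

/-- For constant modulus the set-indexed mixed norm has the same closed form as `bleiMean`, so
`choose_mul_rpow_le` applies to it directly. -/
theorem exists_coeffNorm_le : ∃ C K : ℝ, 1 ≤ C ∧ 0 < K ∧
    ∀ (𝕜 : Type*) [RCLike 𝕜] (d k n : ℕ) (a : IncMap (Fin d) n → 𝕜), 1 ≤ k → k ≤ d →
      ConstModulus a → ∀ ρ : ℝ, 0 < ρ → ρ ≤ 1 / 2 →
      coeffNorm a ≤ (d.choose k : ℝ) ^ (-(1 / 2) : ℝ) * (3 ^ (((d - k : ℕ) : ℝ) / k) *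
        (C ^ k * (cubeNorm a * Real.exp (K * d * ρ ^ (20 / 21 : ℝ)) / ρ ^ k))) := by
  obtain ⟨C, hC, hBH⟩ := exists_sum_norm_rpow_le
  obtain ⟨K, hK, hmix⟩ := exists_norm_mixedPart_le (a := 20 / 21) (by norm_num) (by norm_num)
  refine ⟨C, K, hC, hK, fun 𝕜 _ d k n a hk hkd ha ρ hρ hρ2 => ?_⟩
  have hk0 : (0 : ℝ) < k := by exact_mod_cast hk
  obtain ⟨c, hc, h⟩ := ha.exists_norm_eq
  have hM := cubeNorm_nonneg a
  set R := cubeNorm a * Real.exp (K * d * ρ ^ (20 / 21 : ℝ)) / ρ ^ k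
  have hR : 0 ≤ R := by positivity
  have hF := card_of_toFamily_ne_zero a
  have key := sum_powersetCard_slice_rpow_le (R := R) hk
    (fun G hG hGR => hBH (Fin n) k G R hk hG hGR) hF
    (hmix (Fin n) d (toFamily a) (cubeNorm a) hF (norm_walshPoly_le_cubeNorm a) ρ hρ hρ2 k hkd)
  rw [Finset.sum_congr rfl fun A hA => by
      rw [sum_norm_slice_toFamily_sq hkd h (Finset.mem_powersetCard.mp hA).2],
    Finset.sum_const, nsmul_eq_mul, Finset.card_powersetCard, Finset.card_univ,
    Fintype.card_fin] at key
  rw [coeffNorm_eq h]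
  refine (choose_mul_rpow_le hk hkd hc).trans ?_
  gcongr
  refine (Real.rpow_le_rpow (by positivity) key (by positivity)).trans_eq ?_
  rw [Real.mul_rpow (by positivity) (by positivity), ← Real.rpow_mul (by positivity),
    ← Real.rpow_mul (by positivity), div_mul_div_cancel₀ (by positivity),
    div_self (by positivity), Real.rpow_one]
  congr 2
  field_simp

/-- A bound for the constant-modulus Bohnenblust-Hille constant with a free parameter `k`. -/
theorem exists_BHConst_le : ∃ D : ℝ, 0 < D ∧ ∀ (𝕜 : Type*) [RCLike 𝕜] (d k : ℕ), 1 ≤ k → k ≤ d →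
    BHConst 𝕜 d ≤ ENNReal.ofReal (Real.exp
      (9 / 8 * (d / k) + 11 / 20 * (k * Real.log (d / k)) + D * k)) := by
  obtain ⟨C, K, hC, hK, h⟩ := exists_coeffNorm_le
  have hC0 : 0 < C := by linarith
  have hlogC : 0 ≤ Real.log C := Real.log_nonneg hC
  have hlog2 : 0 < Real.log 2 := Real.log_pos one_lt_two
  refine ⟨Real.log C + K + Real.log 2, by positivity, fun 𝕜 _ d k hk hkd => sInf_le fun n a ha => ?_⟩
  have hk0 : (0 : ℝ) < k := by exact_mod_cast hk
  have hkd' : (k : ℝ) ≤ d := by exact_mod_cast hkd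
  have hd0 : (0 : ℝ) < d := hk0.trans_le hkd'
  have hM := cubeNorm_nonneg a
  rw [← ENNReal.ofReal_mul (by positivity)]
  apply ENNReal.ofReal_le_ofReal
  set L := Real.log (d / k) with hL
  have hdk : (d : ℝ) / k = Real.exp L := (Real.exp_log (by positivity)).symm
  have hL0 : 0 ≤ L := Real.log_nonneg ((one_le_div hk0).mpr hkd')
  -- The radius is `ρ = (1/2) (k/d)^(21/20)`. Then `ρ^(20/21) ≤ k/d`, so the growth factor is at
  -- most `e^(Kk)`. The coefficient `11/20` is `21/20` from `ρ^(-k)` minus `1/2` from the binomial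
  -- gain.
  have hρ : Real.exp (-Real.log 2 - 21 / 20 * L) ≤ 1 / 2 := by
    calc _ ≤ Real.exp (-Real.log 2) := Real.exp_le_exp.mpr (by linarith)
      _ = 1 / 2 := by rw [Real.exp_neg, Real.exp_log two_pos, one_div]
  refine (h 𝕜 d k n a hk hkd ha _ (Real.exp_pos _) hρ).trans ?_
  have e1 : (d.choose k : ℝ) ^ (-(1 / 2) : ℝ) ≤ Real.exp (-(1 / 2) * (k * L)) := by
    have := div_pow_le_choose hk hkd
    rw [hdk, ← Real.exp_nat_mul] at this
    calc _ ≤ (Real.exp (k * L)) ^ (-(1 / 2) : ℝ) :=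
          Real.rpow_le_rpow_of_nonpos (Real.exp_pos _) this (by norm_num)
      _ = _ := by rw [← Real.exp_mul]; congr 1; ring
  have e2 : (3 : ℝ) ^ (((d - k : ℕ) : ℝ) / k) ≤ Real.exp (9 / 8 * (d / k)) := by
    -- `9/8` is a rational upper bound for `log 3`.
    have h3 : (3 : ℝ) ≤ Real.exp (9 / 8) := by
      have h8 : (3 : ℝ) ^ 8 ≤ Real.exp (9 / 8) ^ 8 := by
        rw [← Real.exp_nat_mul]
        have := Real.exp_one_gt_d9
        calc (3 : ℝ) ^ 8 ≤ 2.7 ^ 9 := by norm_num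
          _ ≤ Real.exp 1 ^ 9 := by gcongr; linarith
          _ = _ := by rw [← Real.exp_nat_mul]; norm_num
      exact le_of_pow_le_pow_left₀ (by norm_num) (Real.exp_pos _).le h8
    calc (3 : ℝ) ^ (((d - k : ℕ) : ℝ) / k) ≤ 3 ^ ((d : ℝ) / k) := by
          gcongr
          · norm_num
          · exact Nat.sub_le d k
      _ ≤ Real.exp (9 / 8) ^ ((d : ℝ) / k) := by gcongr
      _ = _ := by rw [← Real.exp_mul]
  have e3 : C ^ k = Real.exp (k * Real.log C) := by rw [Real.exp_nat_mul, Real.exp_log hC0]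
  have e4 : Real.exp (K * d * Real.exp (-Real.log 2 - 21 / 20 * L) ^ (20 / 21 : ℝ)) ≤
      Real.exp (K * k) := by
    apply Real.exp_le_exp.mpr
    rw [mul_assoc, ← Real.exp_mul]
    have : Real.exp ((-Real.log 2 - 21 / 20 * L) * (20 / 21)) ≤ Real.exp (-L) :=
      Real.exp_le_exp.mpr (by linarith)
    rw [Real.exp_neg, ← hdk, inv_div] at this
    calc _ ≤ K * (d * (k / d)) := by gcongr
      _ = _ := by rw [mul_div_cancel₀ _ hd0.ne']
  have e5 : (Real.exp (-Real.log 2 - 21 / 20 * L) ^ k)⁻¹ =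
      Real.exp (k * (Real.log 2 + 21 / 20 * L)) := by
    rw [← Real.exp_nat_mul, ← Real.exp_neg]
    congr 1
    ring
  rw [div_eq_mul_inv _ (Real.exp _ ^ k), e5, e3]
  calc _ ≤ Real.exp (-(1 / 2) * (k * L)) * (Real.exp (9 / 8 * (d / k)) * (Real.exp (k * Real.log C) *
        (cubeNorm a * Real.exp (K * k) * Real.exp (k * (Real.log 2 + 21 / 20 * L))))) := by
        gcongr
    _ = (Real.exp (-(1 / 2) * (k * L)) * Real.exp (9 / 8 * (d / k)) * Real.exp (k * Real.log C) *
        Real.exp (K * k) * Real.exp (k * (Real.log 2 + 21 / 20 * L))) * cubeNorm a := by ring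
    _ = _ := by
        simp only [← Real.exp_add]
        congr 2
        ring

end ConstantModulus

/-! ### Optimization over `k`. -/

section Asymptotics

open Filter

lemma tendsto_natCast_div_log_atTop :
    Tendsto (fun d : ℕ => (d : ℝ) / Real.log d) atTop atTop := by
  have h1 : Tendsto (fun x : ℝ => Real.log x / x) atTop (𝓝[>] 0) := by
    rw [tendsto_nhdsWithin_iff]
    refine ⟨Real.isLittleO_log_id_atTop.tendsto_div_nhds_zero, ?_⟩
    filter_upwards [eventually_gt_atTop 1] with x hx
    have := Real.log_pos hx
    exact div_pos this (by linarith)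
  have h2 := (h1.inv_tendsto_nhdsGT_zero).comp tendsto_natCast_atTop_atTop
  refine h2.congr fun d => ?_
  simp

lemma tendsto_log_natCast_atTop : Tendsto (fun d : ℕ => Real.log d) atTop atTop :=
  Real.tendsto_log_atTop.comp tendsto_natCast_atTop_atTop

lemma tendsto_log_log_div_log :
    Tendsto (fun d : ℕ => Real.log (Real.log d) / Real.log d) atTop (𝓝 0) :=
  (Real.isLittleO_log_id_atTop.tendsto_div_nhds_zero).comp tendsto_log_natCast_atTop

lemma sqrt_mul_log_eq {d : ℕ} (hl : 0 < Real.log d) :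
    Real.sqrt (d * Real.log d) = Real.sqrt (d / Real.log d) * Real.log d := by
  conv_rhs => rw [← Real.sqrt_sq hl.le]
  rw [← Real.sqrt_mul (by positivity), Real.sqrt_sq hl.le]
  congr 1
  field_simp

lemma tendsto_sqrt_mul_log_atTop :
    Tendsto (fun d : ℕ => Real.sqrt (d * Real.log d)) atTop atTop :=
  Real.tendsto_sqrt_atTop.comp
    (tendsto_natCast_atTop_atTop.atTop_mul_atTop₀ tendsto_log_natCast_atTop)

/-- A nearly optimal choice of the parameter `k`. -/
noncomputable def balancedParam (κ : ℝ) (d : ℕ) : ℕ := ⌈κ * Real.sqrt (d / Real.log d)⌉₊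

lemma tendsto_balancedParam_div {κ : ℝ} (hκ : 0 < κ) :
    Tendsto (fun d : ℕ => (balancedParam κ d : ℝ) / Real.sqrt (d / Real.log d)) atTop (𝓝 κ) :=
  (tendsto_nat_ceil_mul_div_atTop hκ.le).comp
    (Real.tendsto_sqrt_atTop.comp tendsto_natCast_div_log_atTop)

lemma eventually_balancedParam {κ : ℝ} (hκ : 0 < κ) :
    ∀ᶠ d : ℕ in atTop, 1 ≤ balancedParam κ d ∧ 2 * balancedParam κ d ≤ d := by
  have hN : Tendsto (fun d : ℕ => Real.sqrt (d / Real.log d)) atTop atTop :=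
    Real.tendsto_sqrt_atTop.comp tendsto_natCast_div_log_atTop
  have h1 := (tendsto_balancedParam_div hκ).mul tendsto_sqrt_mul_log_atTop.inv_tendsto_atTop
  rw [mul_zero] at h1
  filter_upwards [h1.eventually_lt_const (show (0 : ℝ) < 1 / 2 by norm_num),
    hN.eventually_gt_atTop 0, tendsto_log_natCast_atTop.eventually_gt_atTop 0,
    eventually_gt_atTop 0] with d h hN hl hd
  have hd0 : (0 : ℝ) < d := Nat.cast_pos.mpr hd
  refine ⟨Nat.one_le_ceil_iff.mpr (by positivity), ?_⟩
  rw [Pi.inv_apply, sqrt_mul_log_eq hl] at h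
  have e : (balancedParam κ d : ℝ) / Real.sqrt (d / Real.log d) *
      (Real.sqrt (d / Real.log d) * Real.log d)⁻¹ = balancedParam κ d / d := by
    have h2 : Real.sqrt (d / Real.log d) * Real.sqrt (d / Real.log d) = d / Real.log d :=
      Real.mul_self_sqrt (by positivity)
    rw [← div_eq_mul_inv, div_div, ← mul_assoc, h2, div_mul_cancel₀ _ hl.ne']
  rw [e, div_lt_iff₀ hd0] at h
  have : (2 * balancedParam κ d : ℝ) ≤ d := by linarith
  exact_mod_cast this

/-- For `k ≈ κ √(d / log d)` one has `log (d/k) ~ (log d) / 2`, and the term `D k` is of lower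
order. -/
lemma tendsto_balancedParam_cost (A B D : ℝ) {κ : ℝ} (hκ : 0 < κ) :
    Tendsto (fun d : ℕ => (A * (d / balancedParam κ d) +
        B * (balancedParam κ d * Real.log (d / balancedParam κ d)) + D * balancedParam κ d) /
          Real.sqrt (d * Real.log d)) atTop (𝓝 (A / κ + B * κ / 2)) := by
  have hr := tendsto_balancedParam_div hκ
  have hl := tendsto_log_natCast_atTop.inv_tendsto_atTop
  have hlog := hr.log hκ.ne'
  have h := ((hr.inv₀ hκ.ne').const_mul A).add (((hr.mul (((hlog.mul hl).const_sub (1 / 2)).add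
    (tendsto_log_log_div_log.const_mul (1 / 2)))).const_mul B).add ((hr.mul hl).const_mul D))
  have e : A * κ⁻¹ + (B * (κ * (1 / 2 - Real.log κ * 0 + 1 / 2 * 0)) + D * (κ * 0)) =
      A / κ + B * κ / 2 := by ring
  rw [e] at h
  refine h.congr' ?_
  filter_upwards [eventually_balancedParam hκ, tendsto_log_natCast_atTop.eventually_gt_atTop 0,
    eventually_gt_atTop 0, (Real.tendsto_sqrt_atTop.comp
      tendsto_natCast_div_log_atTop).eventually_gt_atTop 0] with d hk hl hd hN
  have hd0 : (0 : ℝ) < d := Nat.cast_pos.mpr hd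
  have hk0 : (0 : ℝ) < balancedParam κ d := by exact_mod_cast hk.1
  simp only [Function.comp_apply] at hN
  rw [sqrt_mul_log_eq hl, Pi.inv_apply]
  set k : ℝ := (balancedParam κ d : ℝ)
  set l := Real.log d
  set N := Real.sqrt (d / l)
  have hN2 : (d : ℝ) = N * N * l := by
    rw [Real.mul_self_sqrt (by positivity), div_mul_cancel₀ _ hl.ne']
  have hlogN : Real.log N = (l - Real.log l) / 2 := by
    rw [Real.log_sqrt (by positivity), Real.log_div hd0.ne' hl.ne']
  have hlr : Real.log (k / N) = Real.log k - (l - Real.log l) / 2 := by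
    rw [Real.log_div hk0.ne' hN.ne', hlogN]
  have hld : Real.log (d / k) = l - Real.log k := Real.log_div hd0.ne' hk0.ne'
  rw [hlr, hld]
  have e1 : (d : ℝ) / k = N * N * l / k := by rw [← hN2]
  rw [e1]
  field_simp
  ring

/-- If `k` is at most a multiple of `√(d log d)`, then `log (d/k)` is at least nearly `(log d) / 2`,
and `d/(2k) + Bk (log d)/2 ≥ √B √(d log d)`. If `k` is larger, `log (d/k) ≥ log 2` already suffices.
The term `-1/2` comes from `(d-k)/(2k)`. -/
lemma eventually_le_cost {B c : ℝ} (hB : 0 < B) (hc : c < Real.sqrt B) :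
    ∀ᶠ d : ℕ in atTop, ∀ k : ℕ, 1 ≤ k → 2 * k ≤ d →
      c * Real.sqrt (d * Real.log d) ≤
        (d : ℝ) / (2 * k) - 1 / 2 + B * (k * Real.log (d / k)) := by
  wlog hc0 : 0 ≤ c generalizing c
  · filter_upwards [this (Real.sqrt_pos.mpr hB) le_rfl] with d hd k hk hkd
    refine le_trans ?_ (hd k hk hkd)
    gcongr
    exact (not_le.mp hc0).le
  obtain ⟨c', hcc', hc'⟩ := exists_between hc
  have hc'0 : 0 < c' := hc0.trans_lt hcc'
  have hlog2 : 0 < Real.log 2 := Real.log_pos one_lt_two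
  -- The threshold is chosen so that `k ≥ m s` forces `B k log 2 ≥ (c + 1) s`; the extra `s ≥ 1`
  -- absorbs the `1/2`.
  set m : ℝ := (c + 1) / (B * Real.log 2)
  have hm : 0 < m := by positivity
  set η : ℝ := (1 - c' ^ 2 / B) / 2 with hη_def
  have hη : 0 < η := by
    have : c' ^ 2 < B := (Real.lt_sqrt hc'0.le).mp hc'
    have : c' ^ 2 / B < 1 := (div_lt_one hB).mpr this
    linarith
  have hsmall := (tendsto_log_natCast_atTop.inv_tendsto_atTop.const_mul (Real.log m)).add
    (tendsto_log_log_div_log.const_mul (1 / 2))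
  rw [mul_zero, mul_zero, add_zero] at hsmall
  filter_upwards [hsmall.eventually_lt_const hη, tendsto_log_natCast_atTop.eventually_gt_atTop 0,
    tendsto_sqrt_mul_log_atTop.eventually_ge_atTop (1 / (2 * (c' - c))),
    tendsto_sqrt_mul_log_atTop.eventually_ge_atTop 1] with d h1 hl h2 h3 k hk hkd
  have hk0 : (0 : ℝ) < k := by exact_mod_cast hk
  have hd0 : (0 : ℝ) < d := by exact_mod_cast (show 0 < d by omega)
  have hkd' : (2 : ℝ) * k ≤ d := by exact_mod_cast hkd
  rw [Pi.inv_apply] at h1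
  have hs2 : Real.sqrt (d * Real.log d) ^ 2 = d * Real.log d := Real.sq_sqrt (by positivity)
  have hlogs : Real.log (Real.sqrt (d * Real.log d)) =
      (Real.log d + Real.log (Real.log d)) / 2 := by
    rw [Real.log_sqrt (by positivity), Real.log_mul hd0.ne' hl.ne']
  set l := Real.log d
  set s := Real.sqrt (d * l)
  have hs0 : 0 < s := by linarith
  rcases le_total (k : ℝ) (m * s) with hkm | hkm
  · have hlog : (c' ^ 2 / B) * (l / 2) ≤ Real.log (d / k) := by
      have h4 : Real.log k ≤ Real.log m + Real.log s := by
        rw [← Real.log_mul hm.ne' hs0.ne']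
        exact Real.log_le_log hk0 hkm
      rw [Real.log_div hd0.ne' hk0.ne']
      have h5 : Real.log m + 1 / 2 * Real.log l ≤ η * l := by
        have := mul_le_mul_of_nonneg_right h1.le hl.le
        calc _ = (Real.log m * l⁻¹ + 1 / 2 * (Real.log l / l)) * l := by field_simp
          _ ≤ _ := this
      have h6 : (c' ^ 2 / B) * (l / 2) = l / 2 - η * l := by rw [hη_def]; ring
      rw [h6]
      linarith
    have h7 : c' ^ 2 * (k * (l / 2)) ≤ B * (k * Real.log (d / k)) := by
      calc _ = B * (k * ((c' ^ 2 / B) * (l / 2))) := by field_simp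
        _ ≤ _ := by gcongr
    have h8 : c' * s ≤ (d : ℝ) / (2 * k) + c' ^ 2 * (k * (l / 2)) := by
      have h9 : (d : ℝ) / (2 * k) + c' ^ 2 * (k * (l / 2)) - c' * s =
          (s - c' * k * l) ^ 2 / (2 * k * l) := by
        rw [sub_sq, hs2]
        field_simp
        ring
      have : 0 ≤ (s - c' * k * l) ^ 2 / (2 * k * l) := by positivity
      linarith
    have h10 : 1 / 2 ≤ (c' - c) * s := by
      have := mul_le_mul_of_nonneg_left h2 (sub_pos.mpr hcc').le
      have e : (c' - c) * (1 / (2 * (c' - c))) = 1 / 2 := by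
        have := (sub_pos.mpr hcc').ne'
        field_simp
      linarith
    linarith
  · have h4 : Real.log 2 ≤ Real.log (d / k) := by
      apply Real.log_le_log two_pos
      rwa [le_div_iff₀ hk0]
    have h5 : (c + 1) * s ≤ B * (k * Real.log (d / k)) := by
      calc (c + 1) * s = B * (m * s * Real.log 2) := by
            simp only [m]
            field_simp
        _ ≤ _ := by gcongr
    have h6 : (0 : ℝ) ≤ d / (2 * k) := by positivity
    linarith

/-- Two-sided bounds for a factor that depends on `d` and `k`. -/
def CostBounds (B : ℝ) (G : ℕ → ℕ → ℝ) : Prop :=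
  ∀ d k : ℕ, 1 ≤ k → 2 * k ≤ d →
    Real.exp ((d : ℝ) / (2 * k) - 1 / 2 + B * (k * Real.log (d / k))) ≤ G d k ∧
    G d k ≤ Real.exp ((d : ℝ) / (2 * k) + B * (k * Real.log (d / k)) + k)

lemma CostBounds.exists_mul_exp_le {B : ℝ} {G : ℕ → ℕ → ℝ} (hG : CostBounds B G) (hB : 0 < B)
    {c : ℝ} (hc0 : 0 ≤ c) (hc : c < Real.sqrt B) :
    ∃ c₀ : ℝ, 0 < c₀ ∧ ∀ d k : ℕ, 1 ≤ k → 2 * k ≤ d →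
      c₀ * Real.exp (c * Real.sqrt (d * Real.log d)) ≤ G d k := by
  obtain ⟨d₀, h⟩ := eventually_atTop.mp (eventually_le_cost hB hc)
  refine ⟨Real.exp (-1 / 2 - c * d₀), Real.exp_pos _, fun d k hk hkd => ?_⟩
  refine le_trans ?_ (hG d k hk hkd).1
  rw [← Real.exp_add]
  apply Real.exp_le_exp.mpr
  have hk0 : (0 : ℝ) < k := by exact_mod_cast hk
  have hkd' : (2 : ℝ) * k ≤ d := by exact_mod_cast hkd
  have hd0 : (0 : ℝ) < d := by linarith
  rcases le_total d₀ d with hd | hd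
  · have := h d hd k hk hkd
    have h1 : 0 ≤ c * d₀ := by positivity
    linarith
  · have h1 : Real.sqrt (d * Real.log d) ≤ d₀ := by
      rw [Real.sqrt_le_left (by positivity)]
      have h2 : (d : ℝ) ≤ d₀ := by exact_mod_cast hd
      have h3 := Real.log_le_self hd0.le
      calc (d : ℝ) * Real.log d ≤ d * d := by gcongr
        _ ≤ d₀ * d₀ := by gcongr
        _ = _ := by ring
    have h2 : 0 ≤ Real.log (d / k) := Real.log_nonneg (by rw [le_div_iff₀ hk0]; linarith)
    have h3 : 0 ≤ (d : ℝ) / (2 * k) + B * (k * Real.log (d / k)) := by positivity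
    have h4 := mul_le_mul_of_nonneg_left h1 hc0
    linarith

lemma CostBounds.tendsto_log_iInf {B : ℝ} {G : ℕ → ℕ → ℝ} (hG : CostBounds B G) (hB : 0 < B) :
    Tendsto (fun d : ℕ => Real.log (⨅ k : Finset.Icc 1 (d / 2), G d k) /
      Real.sqrt (d * Real.log d)) atTop (𝓝 (Real.sqrt B)) := by
  have hmem : ∀ {d k : ℕ}, k ∈ Finset.Icc 1 (d / 2) ↔ 1 ≤ k ∧ 2 * k ≤ d := fun {d k} => by
    rw [Finset.mem_Icc, Nat.le_div_iff_mul_le two_pos, mul_comm]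
  have hGpos : ∀ {d k : ℕ}, 1 ≤ k → 2 * k ≤ d → 0 < G d k := fun hk hkd =>
    (Real.exp_pos _).trans_le (hG _ _ hk hkd).1
  have hmin : ∀ d : ℕ, 2 ≤ d → ∃ k : ℕ, 1 ≤ k ∧ 2 * k ≤ d ∧
      (⨅ k : Finset.Icc 1 (d / 2), G d k) = G d k := fun d hd => by
    have : Nonempty (Finset.Icc 1 (d / 2)) := ⟨⟨1, hmem.mpr ⟨le_rfl, hd⟩⟩⟩
    obtain ⟨k, hk⟩ := exists_eq_ciInf_of_finite (f := fun k : Finset.Icc 1 (d / 2) => G d k)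
    exact ⟨k, (hmem.mp k.2).1, (hmem.mp k.2).2, hk.symm⟩
  have hsB : 0 < Real.sqrt B := Real.sqrt_pos.mpr hB
  refine tendsto_order.mpr ⟨fun c hc => ?_, fun c hc => ?_⟩
  · obtain ⟨c', hcc', hc'⟩ := exists_between hc
    filter_upwards [eventually_le_cost hB hc', eventually_ge_atTop 2,
      tendsto_sqrt_mul_log_atTop.eventually_gt_atTop 0] with d h hd hs
    obtain ⟨k, hk, hkd, e⟩ := hmin d hd
    rw [e]
    refine hcc'.trans_le ?_
    rw [le_div_iff₀ hs]
    refine (h k hk hkd).trans ?_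
    rw [Real.le_log_iff_exp_le (hGpos hk hkd)]
    exact (hG d k hk hkd).1
  -- `κ = 1/√B` equalizes `1/(2κ)` and `Bκ/2`, whose sum is then `√B`.
  · have hκ : 0 < (Real.sqrt B)⁻¹ := inv_pos.mpr hsB
    have hlim := tendsto_balancedParam_cost (1 / 2) B 1 hκ
    have e : 1 / 2 / (Real.sqrt B)⁻¹ + B * (Real.sqrt B)⁻¹ / 2 = Real.sqrt B := by
      have : B * (Real.sqrt B)⁻¹ = Real.sqrt B := by
        rw [← div_eq_mul_inv, Real.div_sqrt]
      rw [this, div_inv_eq_mul]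
      ring
    rw [e] at hlim
    filter_upwards [hlim.eventually_lt_const hc, eventually_balancedParam hκ, eventually_ge_atTop 2,
      tendsto_sqrt_mul_log_atTop.eventually_gt_atTop 0] with d h hk hd hs
    refine lt_of_le_of_lt ?_ h
    set k := balancedParam (Real.sqrt B)⁻¹ d
    obtain ⟨k', hk', hkd', e'⟩ := hmin d hd
    have hle : (⨅ k : Finset.Icc 1 (d / 2), G d k) ≤ G d k :=
      ciInf_le (f := fun k : Finset.Icc 1 (d / 2) => G d k) (Set.finite_range _).bddBelow
        ⟨k, hmem.mpr hk⟩
    have hpos : 0 < ⨅ k : Finset.Icc 1 (d / 2), G d k := e' ▸ hGpos hk' hkd'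
    gcongr
    rw [Real.log_le_iff_le_exp hpos]
    refine hle.trans ((hG d k hk.1 hk.2).2.trans_eq ?_)
    congr 1
    ring

lemma choose_mul_pow_mul_pow_le {k d : ℕ} (hkd : k ≤ d) :
    d.choose k * (k ^ k * (d - k) ^ (d - k)) ≤ d ^ d := by
  have h := add_pow k (d - k) d
  rw [Nat.add_sub_cancel' hkd] at h
  rw [h, mul_comm]
  exact Finset.single_le_sum (f := fun m => k ^ m * (d - k) ^ (d - m) * d.choose m)
    (fun _ _ => Nat.zero_le _) (Finset.mem_range.mpr (Nat.lt_succ_of_le hkd))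

lemma middle_factor_bounds {k d : ℕ} (hk : 1 ≤ k) (hkd : 2 * k ≤ d) :
    (d.choose k : ℝ) ≤ (d : ℝ) ^ d / ((k : ℝ) ^ k * ((d : ℝ) - k) ^ (d - k)) ∧
    Real.exp (k * Real.log (d / k)) ≤
      (d : ℝ) ^ d / ((k : ℝ) ^ k * ((d : ℝ) - k) ^ (d - k)) ∧
    (d : ℝ) ^ d / ((k : ℝ) ^ k * ((d : ℝ) - k) ^ (d - k)) ≤
      Real.exp (k * Real.log (d / k) + k) := by
  have hk0 : (0 : ℝ) < k := by exact_mod_cast hk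
  have hkd' : (2 : ℝ) * k ≤ d := by exact_mod_cast hkd
  have hd0 : (0 : ℝ) < d := by linarith
  have hdk : (0 : ℝ) < d - k := by linarith
  have hle : k ≤ d := by omega
  -- The second factor on the right lies between `1` and `e^k`.
  have e : (d : ℝ) ^ d / ((k : ℝ) ^ k * ((d : ℝ) - k) ^ (d - k)) =
      Real.exp (k * Real.log (d / k)) * ((d : ℝ) / (d - k)) ^ (d - k) := by
    rw [Real.exp_nat_mul, Real.exp_log (by positivity), div_pow, div_pow, div_mul_div_comm,
      ← pow_add, Nat.add_sub_cancel' hle]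
  refine ⟨?_, ?_, ?_⟩
  · rw [le_div_iff₀ (by positivity)]
    have := choose_mul_pow_mul_pow_le hle
    have h2 : ((d.choose k * (k ^ k * (d - k) ^ (d - k)) : ℕ) : ℝ) ≤ ((d ^ d : ℕ) : ℝ) := by
      exact_mod_cast this
    push_cast [Nat.cast_sub hle] at h2
    exact h2
  · rw [e]
    refine le_mul_of_one_le_right (Real.exp_pos _).le (one_le_pow₀ ?_)
    rw [one_le_div hdk]
    linarith
  · rw [e, Real.exp_add]
    gcongr
    have h1 : (d : ℝ) / (d - k) ≤ Real.exp (k / (d - k)) := by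
      have h2 := Real.add_one_le_exp ((k : ℝ) / (d - k))
      have h3 : (d : ℝ) / (d - k) = k / (d - k) + 1 := by
        field_simp
        ring
      rwa [h3]
    calc ((d : ℝ) / (d - k)) ^ (d - k) ≤ Real.exp (k / (d - k)) ^ (d - k) := by gcongr
      _ = Real.exp k := by
        rw [← Real.exp_nat_mul, Nat.cast_sub hle, mul_div_cancel₀ _ hdk.ne']

lemma costBounds_plainFactor : CostBounds 2 plainFactor := by
  intro d k hk hkd
  have hk0 : (0 : ℝ) < k := by exact_mod_cast hk
  have hkd' : (2 : ℝ) * k ≤ d := by exact_mod_cast hkd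
  have hd0 : (0 : ℝ) < d := by linarith
  obtain ⟨-, h2, h3⟩ := middle_factor_bounds hk hkd
  have e : ((d : ℝ) / k) ^ k = Real.exp (k * Real.log (d / k)) := by
    rw [Real.exp_nat_mul, Real.exp_log (by positivity)]
  have e2 : ((d : ℝ) - k) / (2 * k) = d / (2 * k) - 1 / 2 := by field_simp
  rw [plainFactor, e, e2]
  have hm := (Real.exp_pos _).le.trans h2
  constructor
  · calc _ = Real.exp (d / (2 * k) - 1 / 2) * Real.exp (k * Real.log (d / k)) *
          Real.exp (k * Real.log (d / k)) := by
          rw [← Real.exp_add, ← Real.exp_add]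
          ring_nf
      _ ≤ _ := by gcongr
  · calc _ ≤ Real.exp (d / (2 * k)) * Real.exp (k * Real.log (d / k) + k) *
          Real.exp (k * Real.log (d / k)) := by
          gcongr
          linarith
      _ = _ := by
          rw [← Real.exp_add, ← Real.exp_add]
          ring_nf

lemma costBounds_gainFactor : CostBounds (3 / 2) gainFactor := by
  intro d k hk hkd
  have hk0 : (0 : ℝ) < k := by exact_mod_cast hk
  have hkd' : (2 : ℝ) * k ≤ d := by exact_mod_cast hkd
  have hd0 : (0 : ℝ) < d := by linarith
  obtain ⟨h1, h2, -⟩ := middle_factor_bounds hk hkd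
  have hC : (0 : ℝ) < d.choose k := by exact_mod_cast Nat.choose_pos (show k ≤ d by omega)
  have e : ((d : ℝ) / k) ^ k = Real.exp (k * Real.log (d / k)) := by
    rw [Real.exp_nat_mul, Real.exp_log (by positivity)]
  have e2 : ((d : ℝ) - k) / (2 * k) = d / (2 * k) - 1 / 2 := by field_simp
  rw [gainFactor]
  constructor
  · rw [plainFactor, e, e2]
    set m := (d : ℝ) ^ d / ((k : ℝ) ^ k * ((d : ℝ) - k) ^ (d - k))
    have hm : 0 < m := hC.trans_le h1
    -- Since `C(d,k) ≤ m`, the gain removes at most a square root of `m`, and `m ≥ (d/k)^k`.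
    have h4 : Real.exp (1 / 2 * (k * Real.log (d / k))) ≤ (d.choose k : ℝ) ^ (-(1 / 2) : ℝ) * m := by
      calc _ = Real.exp (k * Real.log (d / k)) ^ (1 / 2 : ℝ) := by
            rw [← Real.exp_mul]
            ring_nf
        _ ≤ m ^ (1 / 2 : ℝ) := by gcongr
        _ = m ^ (-(1 / 2) : ℝ) * m := by
            conv_rhs => rw [← Real.rpow_one m, ← Real.rpow_mul hm.le, ← Real.rpow_add hm]
            norm_num
        _ ≤ _ := mul_le_mul_of_nonneg_right
            (Real.rpow_le_rpow_of_nonpos hC h1 (by norm_num)) hm.le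
    calc _ = Real.exp (d / (2 * k) - 1 / 2) * Real.exp (1 / 2 * (k * Real.log (d / k))) *
          Real.exp (k * Real.log (d / k)) := by
          rw [← Real.exp_add, ← Real.exp_add]
          ring_nf
      _ ≤ Real.exp (d / (2 * k) - 1 / 2) * ((d.choose k : ℝ) ^ (-(1 / 2) : ℝ) * m) *
          Real.exp (k * Real.log (d / k)) := by gcongr
      _ = _ := by ring
  · have h5 : (d.choose k : ℝ) ^ (-(1 / 2) : ℝ) ≤ Real.exp (-(1 / 2) * (k * Real.log (d / k))) := by
      have := div_pow_le_choose hk (show k ≤ d by omega)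
      rw [e] at this
      calc _ ≤ (Real.exp (k * Real.log (d / k))) ^ (-(1 / 2) : ℝ) :=
            Real.rpow_le_rpow_of_nonpos (Real.exp_pos _) this (by norm_num)
        _ = _ := by rw [← Real.exp_mul]; congr 1; ring
    have h6 := (costBounds_plainFactor d k hk hkd).2
    have h7 : 0 ≤ plainFactor d k := (Real.exp_pos _).le.trans (costBounds_plainFactor d k hk hkd).1
    calc _ ≤ Real.exp (-(1 / 2) * (k * Real.log (d / k))) *
          Real.exp (d / (2 * k) + 2 * (k * Real.log (d / k)) + k) := by gcongr
      _ = _ := by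
          rw [← Real.exp_add]
          ring_nf

/-- The constant-modulus Bohnenblust-Hille constants are `O(exp ((6 / 5) √(d log d)))`. -/
theorem exists_BHConst_le_exp : ∃ C : ℝ, 0 < C ∧ ∀ (𝕜 : Type*) [RCLike 𝕜] (d : ℕ), 1 ≤ d →
    BHConst 𝕜 d ≤ ENNReal.ofReal (C * Real.exp (6 / 5 * Real.sqrt (d * Real.log d))) := by
  obtain ⟨D, hD, h⟩ := exists_BHConst_le
  -- With `κ = 2` the limit is `9/16 + 11/20 = 1.1125`, below `6/5`.
  have hlim := tendsto_balancedParam_cost (9 / 8) (11 / 20) D two_pos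
  obtain ⟨d₀, h₀⟩ := eventually_atTop.mp
    ((hlim.eventually_lt_const (show 9 / 8 / 2 + 11 / 20 * 2 / 2 < (6 / 5 : ℝ) by norm_num)).and
      ((eventually_balancedParam two_pos).and (tendsto_sqrt_mul_log_atTop.eventually_gt_atTop 0)))
  set β : ℕ → ℝ := fun d => Real.exp
    (9 / 8 * (d / (1 : ℕ)) + 11 / 20 * ((1 : ℕ) * Real.log (d / (1 : ℕ))) + D * (1 : ℕ))
  have hβ : ∀ d, 0 < β d := fun d => Real.exp_pos _
  have hsum : 0 ≤ ∑ d ∈ Finset.range d₀, β d := Finset.sum_nonneg fun d _ => (hβ d).le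
  -- The finitely many small `d` are covered by the bound `β d` for `k = 1`; the sum dominates each
  -- of them.
  refine ⟨1 + ∑ d ∈ Finset.range d₀, β d, by positivity, fun 𝕜 _ d hd => ?_⟩
  rcases lt_or_ge d d₀ with hd' | hd'
  · refine (h 𝕜 d 1 le_rfl hd).trans (ENNReal.ofReal_le_ofReal ?_)
    have h1 : β d ≤ ∑ d ∈ Finset.range d₀, β d :=
      Finset.single_le_sum (f := β) (fun d _ => (hβ d).le) (Finset.mem_range.mpr hd')
    have h2 : 1 ≤ Real.exp (6 / 5 * Real.sqrt (d * Real.log d)) := Real.one_le_exp (by positivity)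
    calc β d ≤ (1 + ∑ d ∈ Finset.range d₀, β d) * 1 := by linarith
      _ ≤ _ := by gcongr
  · obtain ⟨h1, ⟨hk, hkd⟩, hs⟩ := h₀ d hd'
    refine (h 𝕜 d (balancedParam 2 d) hk (by omega)).trans (ENNReal.ofReal_le_ofReal ?_)
    rw [div_lt_iff₀ hs] at h1
    refine (Real.exp_le_exp.mpr h1.le).trans ?_
    exact le_mul_of_one_le_left (Real.exp_pos _).le (by linarith)

end Asymptotics

theorem mainTheorem3 (𝕜 : Type*) [RCLike 𝕜] :
    -- Blei's inequality with the gain, for coefficients of constant modulus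
    (∀ (d k n : ℕ), 1 ≤ k → k ≤ d → ∀ a : IncMap (Fin d) n → 𝕜, ConstModulus a →
      coeffNorm a ≤ (d.choose k : ℝ) ^ (-(1 / 2) : ℝ) * bleiMean k a) ∧
    -- the estimate of the ratio; its denominator is a positive finite number
    (∀ k : ℕ, 1 ≤ k → 0 < BH 𝕜 k ∧ BH 𝕜 k < ⊤) ∧
    (∃ C : ℝ, 0 < C ∧ ∀ d k : ℕ, 1 ≤ k → 2 * k ≤ d →
      BHConst 𝕜 d / BH 𝕜 k ≤ ENNReal.ofReal (C * gainFactor d k)) ∧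
    -- optimization over `k`, with and without the gain
    Filter.Tendsto
      (fun d : ℕ => Real.log (⨅ k : Finset.Icc 1 (d / 2), gainFactor d k) /
        Real.sqrt (d * Real.log d)) Filter.atTop (𝓝 (Real.sqrt (3 / 2))) ∧
    Filter.Tendsto
      (fun d : ℕ => Real.log (⨅ k : Finset.Icc 1 (d / 2), plainFactor d k) /
        Real.sqrt (d * Real.log d)) Filter.atTop (𝓝 (Real.sqrt 2)) ∧
    -- the resulting bound: every `C₀` larger than `√(3/2)` is admissible
    (∀ C₀ : ℝ, Real.sqrt (3 / 2) < C₀ → ∃ C : ℝ, 0 < C ∧ ∀ d : ℕ, 1 ≤ d →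
      BHConst 𝕜 d ≤
        ENNReal.ofReal (C * Real.exp (C₀ * Real.sqrt (d * Real.log d)))) := by
  obtain ⟨C, hC, hconst⟩ := exists_BHConst_le_exp
  have h65 : (6 / 5 : ℝ) < Real.sqrt (3 / 2) := Real.lt_sqrt_of_sq_lt (by norm_num)
  refine ⟨fun d k n hk hkd a ha => coeffNorm_le_bleiMean hk hkd ha, fun k hk => ⟨?_, ?_⟩, ?_,
    costBounds_gainFactor.tendsto_log_iInf (by norm_num),
    costBounds_plainFactor.tendsto_log_iInf (by norm_num), fun C₀ hC₀ => ⟨C, hC, fun d hd => ?_⟩⟩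
  · exact zero_lt_one.trans_le (one_le_BH 𝕜 k)
  · obtain ⟨M, -, hM⟩ := exists_BH_le
    exact (hM 𝕜 k hk).trans_lt ENNReal.ofReal_lt_top
  · obtain ⟨c₀, hc₀, hgain⟩ := costBounds_gainFactor.exists_mul_exp_le (by norm_num)
      (show (0 : ℝ) ≤ 6 / 5 by norm_num) h65
    refine ⟨C / c₀, by positivity, fun d k hk hkd => ?_⟩
    -- The denominator is used only through `BH 𝕜 k ≥ 1`; the dependence on `k` enters through the
    -- uniform lower bound `hgain`.
    calc BHConst 𝕜 d / BH 𝕜 k ≤ BHConst 𝕜 d / 1 := ENNReal.div_le_div_left (one_le_BH 𝕜 k) _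
      _ = BHConst 𝕜 d := div_one _
      _ ≤ ENNReal.ofReal (C * Real.exp (6 / 5 * Real.sqrt (d * Real.log d))) :=
        hconst 𝕜 d (by omega)
      _ ≤ _ := by
        apply ENNReal.ofReal_le_ofReal
        calc C * Real.exp (6 / 5 * Real.sqrt (d * Real.log d)) =
              C / c₀ * (c₀ * Real.exp (6 / 5 * Real.sqrt (d * Real.log d))) := by field_simp
          _ ≤ _ := mul_le_mul_of_nonneg_left (hgain d k hk hkd) (by positivity)
  · refine (hconst 𝕜 d hd).trans (ENNReal.ofReal_le_ofReal ?_)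
    gcongr
    linarith
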